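/- **Setting.** Let $\mathscr G$ be an ample groupoid: a topological groupoid (not necessarily Hausdorff) whose unit space $\mathscr G^{(0)}$ is locally compact and Hausdorff with a basis of compact open sets and whose range map $r$ is a local homeomorphism; $d$ denotes the domain (source) map. A $\mathscr G$-sheaf of unital rings $\mathcal O=(E,p,\alpha)$ is a local homeomorphism $p\colon E\to\mathscr G^{(0)}$ with a unital ring structure on each stalk $\mathcal O_x=p^{-1}(x)$ such that the fibrewise addition and multiplication and the unit section $x\mapsto 1_x$ are continuous, together with a continuous action $\mathscr G\times_{d,p}E\to E$, $(\gamma,e)\mapsto\alpha_\gamma(e)$, of the groupoid by ring homomorphisms $\alpha_\gamma\colon\mathcal O_{d(\gamma)}\to\mathcal O_{r(\gamma)}$ (units act as identities, and $\alpha_\beta\alpha_\gamma=\alpha_{\beta\gamma}$). It is a $\mathscr G$-sheaf of fields if every stalk is a field. The ring $\Gamma_c(\mathscr G,\mathcal O)$ is the additive group generated by all maps $f\colon\mathscr G\to E$ with $f(\gamma)\in\mathcal O_{r(\gamma)}$ for which there is a compact open bisection $U$ such that $f|_U$ is continuous and $f$ vanishes off $U$; its product is the convolution $(f*g)(\gamma)=\sum_{\beta\rho=\gamma}f(\beta)\,\alpha_\beta(g(\rho))$.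 In general it has no unit. Its subring $\Gamma_c(\mathscr G^{(0)},\mathcal O)$ is generated additively by those maps $f$ for which $U$ can be chosen inside $\mathscr G^{(0)}$. A ring (possibly without unit) is semiprimitive if its Jacobson radical, the intersection of the annihilators of all simple left modules, is zero; a simple module $M$ over $R$ is one with $RM\neq 0$ whose only submodules are $0$ and $M$, and a semisimple module is a sum of simple submodules. For $x\in\mathscr G^{(0)}$ let $\mathscr G_x^x$ be the isotropy group at $x$ and let $B_x=\mathcal O_x\rtimes\mathscr G_x^x$ be the skew group ring, with $a\delta\cdot b\eta=a\,\alpha_\delta(b)\,\delta\eta$. Let $\mathcal L_x=\bigoplus_{d(\gamma)=x}\mathcal O_{r(\gamma)}1_\gamma$; it is a $\Gamma_c(\mathscr G,\mathcal O)$-$B_x$-bimodule via $f\cdot a1_\gamma=\sum_{d(\beta)=r(\gamma)}f(\beta)\alpha_\beta(a)1_{\beta\gamma}$ and $a1_\gamma\cdot b\delta=a\,\alpha_\gamma(b)1_{\gamma\delta}$. For a left $B_x$-module $M$ put $\mathrm{Ind}_x(M)=\mathcal L_x\otimes_{B_x}M$, a left $\Gamma_c(\mathscr G,\mathcal O)$-module.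 **Theorem.** Let $\mathscr G$ be an ample groupoid and $\mathcal O$ a $\mathscr G$-sheaf of fields such that $\Gamma_c(\mathscr G^{(0)},\mathcal O)$ is a maximal commutative subring of $\Gamma_c(\mathscr G,\mathcal O)$. Then $\Gamma_c(\mathscr G,\mathcal O)$ is semiprimitive. Moreover, for every choice of a simple left $B_x$-module $M_x$ for each $x\in\mathscr G^{(0)}$, the module $\bigoplus_{x\in\mathscr G^{(0)}}\mathrm{Ind}_x(M_x)$ is a faithful semisimple left $\Gamma_c(\mathscr G,\mathcal O)$-module. -/

import Mathlib

open CategoryTheory DirectSum TensorProduct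

universe u v w t

set_option linter.unusedSectionVars false

namespace SheafAlgebra

/-! ### Ample groupoids

A groupoid is Mathlib's `CategoryTheory.Groupoid`: the type of objects `X` plays the role of the
unit space and `Arr X` that of the arrow space.  For an arrow `γ : x ⟶ y` the domain is `x` and
the range is `y`; the product `βγ` of algebraists (first `γ`, then `β`) is `γ ≫ β`. -/

/-- The space of all arrows; `γ.left` is the domain and `γ.right` the range of `γ`. -/
abbrev Arr (X : Type u) [Groupoid.{v} X] : Type (max u v) := Quiver.Total X

/-- The fibre of the domain map over `x`: all arrows with domain `x`. -/
abbrev Out {X : Type u} [Groupoid.{v} X] (x : X) : Type (max u v) := Σ y : X, (x ⟶ y)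

/-- An arrow with domain `x`, as an element of the arrow space. -/
abbrev Out.arr {X : Type u} [Groupoid.{v} X] {x : X} (ρ : Out x) : Arr X := ⟨x, ρ.1, ρ.2⟩

/-- Pairs of composable arrows. -/
structure ComposablePair (X : Type u) [Groupoid.{v} X] where
  {dom : X}
  {mid : X}
  {cod : X}
  first : dom ⟶ mid
  second : mid ⟶ cod

/-- Composable pairs carry the subspace topology of the product of two copies of the arrow
space. -/
instance (X : Type u) [Groupoid.{v} X] [TopologicalSpace (Arr X)] :
    TopologicalSpace (ComposablePair X) :=
  TopologicalSpace.induced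
    (fun p => ((⟨p.dom, p.mid, p.first⟩ : Arr X), (⟨p.mid, p.cod, p.second⟩ : Arr X)))
    inferInstance

/-- Ample groupoids: étale topological groupoids (with locally compact Hausdorff unit space)
whose unit space has a basis of compact open sets.  The arrow space need not be Hausdorff. -/
class IsAmpleGroupoid (X : Type u) [Groupoid.{v} X] [TopologicalSpace X]
    [TopologicalSpace (Arr X)] : Prop where
  continuous_dom : Continuous (fun γ : Arr X => γ.left)
  continuous_unit : Continuous (fun x : X => (⟨x, x, 𝟙 x⟩ : Arr X))
  continuous_comp : Continuous
    (fun p : ComposablePair X => (⟨p.dom, p.cod, p.first ≫ p.second⟩ : Arr X))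
  continuous_inv : Continuous
    (fun γ : Arr X => (⟨γ.right, γ.left, Groupoid.inv γ.hom⟩ : Arr X))
  t2 : T2Space X
  locallyCompact : LocallyCompactSpace X
  isLocalHomeomorph_range : IsLocalHomeomorph (fun γ : Arr X => γ.right)
  isTopologicalBasis_compactOpen :
    TopologicalSpace.IsTopologicalBasis {U : Set X | IsOpen U ∧ IsCompact U}

/-- The set of unit arrows. -/
def unitArrows (X : Type u) [Groupoid.{v} X] : Set (Arr X) :=
  Set.range (fun x : X => (⟨x, x, 𝟙 x⟩ : Arr X))

/-- Compact open bisections.  (A compact set on which the continuous domain map into the Hausdorff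
unit space is injective is automatically Hausdorff.) -/
structure IsCompactOpenBisection {X : Type u} [Groupoid.{v} X] [TopologicalSpace (Arr X)]
    (U : Set (Arr X)) : Prop where
  isOpen : IsOpen U
  isCompact : IsCompact U
  injOn_dom : Set.InjOn (fun γ : Arr X => γ.left) U
  injOn_range : Set.InjOn (fun γ : Arr X => γ.right) U

/-! ### Sheaves of rings over a groupoid -/

/-- Pairs of points in a common stalk, i.e. the pullback `E ×_{p,p} E`. -/
structure FibrePair {X : Type u} (S : X → Type w) where
  {pt : X}
  fst : S pt
  snd : S pt

instance {X : Type u} (S : X → Type w) [TopologicalSpace (Σ x, S x)] :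
    TopologicalSpace (FibrePair S) :=
  TopologicalSpace.induced
    (fun p => ((⟨p.pt, p.fst⟩ : Σ x, S x), (⟨p.pt, p.snd⟩ : Σ x, S x))) inferInstance

/-- An arrow together with a point in the stalk over its domain, i.e. the pullback
`𝒢 ×_{d,p} E`. -/
structure ActPair {X : Type u} [Groupoid.{v} X] (S : X → Type w) where
  {dom : X}
  {cod : X}
  arrow : dom ⟶ cod
  val : S dom

instance {X : Type u} [Groupoid.{v} X] (S : X → Type w) [TopologicalSpace (Arr X)]
    [TopologicalSpace (Σ x, S x)] : TopologicalSpace (ActPair S) :=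
  TopologicalSpace.induced
    (fun p => ((⟨p.dom, p.cod, p.arrow⟩ : Arr X), (⟨p.dom, p.val⟩ : Σ x, S x))) inferInstance

/-- A `𝒢`-sheaf of unital rings, as an étale space `E = Σ x, stalk x` over the unit space with a
continuous action of the groupoid by ring homomorphisms between the stalks. -/
structure GSheafOfRings (X : Type u) [Groupoid.{v} X] [TopologicalSpace X]
    [TopologicalSpace (Arr X)] where
  stalk : X → Type w
  [ring : ∀ x, Ring (stalk x)]
  [topology : TopologicalSpace (Σ x, stalk x)]
  isLocalHomeomorph_proj : IsLocalHomeomorph (fun e : Σ x, stalk x => e.1)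
  continuous_add : Continuous
    (fun p : FibrePair stalk => (⟨p.pt, p.fst + p.snd⟩ : Σ x, stalk x))
  continuous_mul : Continuous
    (fun p : FibrePair stalk => (⟨p.pt, p.fst * p.snd⟩ : Σ x, stalk x))
  continuous_one : Continuous (fun x : X => (⟨x, 1⟩ : Σ x, stalk x))
  act : ∀ {x y : X}, (x ⟶ y) → (stalk x →+* stalk y)
  act_id : ∀ (x : X) (a : stalk x), act (𝟙 x) a = a
  act_comp : ∀ {x y z : X} (γ : x ⟶ y) (β : y ⟶ z) (a : stalk x),
    act (γ ≫ β) a = act β (act γ a)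
  continuous_act : Continuous
    (fun p : ActPair stalk => (⟨p.cod, act p.arrow p.val⟩ : Σ x, stalk x))

attribute [instance] GSheafOfRings.ring GSheafOfRings.topology

/-- A sheaf of fields: every stalk is a field. -/
def GSheafOfRings.IsSheafOfFields {X : Type u} [Groupoid.{v} X] [TopologicalSpace X]
    [TopologicalSpace (Arr X)] (𝒪 : GSheafOfRings.{u, v, w} X) : Prop :=
  ∀ x : X, IsField (𝒪.stalk x)

section Convolution

variable {X : Type u} [Groupoid.{v} X] [TopologicalSpace X] [TopologicalSpace (Arr X)]
  (𝒪 : GSheafOfRings.{u, v, w} X)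

/-- All (not necessarily continuous) maps `f` from the arrows to the étale space with
`p ∘ f = r`. -/
abbrev Sections : Type (max u v w) := ∀ γ : Arr X, 𝒪.stalk γ.right

variable {𝒪}

/-- A section as a map into the étale space. -/
def toSpace (f : Sections 𝒪) (γ : Arr X) : Σ x, 𝒪.stalk x := ⟨γ.right, f γ⟩

/-- `f` is continuous on `U` and vanishes off `U`. -/
def SupportedOn (f : Sections 𝒪) (U : Set (Arr X)) : Prop :=
  ContinuousOn (toSpace f) U ∧ ∀ γ, γ ∉ U → f γ = 0

/-- The convolution `(f * g)(γ) = ∑_{βρ = γ} f(β) α_β(g(ρ))`; the factorizations `γ = βρ` are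
parametrized by the arrow `ρ` with the same domain as `γ`, and then `β = γρ⁻¹`. -/
noncomputable def conv (f g : Sections 𝒪) : Sections 𝒪 := fun γ =>
  ∑ᶠ ρ : Out γ.left, f ⟨ρ.1, γ.right, Groupoid.inv ρ.2 ≫ γ.hom⟩ *
    𝒪.act (Groupoid.inv ρ.2 ≫ γ.hom) (g ρ.arr)

variable (𝒪)

/-- The additive group `Γ_c(𝒢, 𝒪)`: it is generated by the sections that are supported on a
compact open bisection. -/
def gammaSubgroup : AddSubgroup (Sections 𝒪) :=
  AddSubgroup.closure {f | ∃ U : Set (Arr X), IsCompactOpenBisection U ∧ SupportedOn f U}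

/-- The additive group `Γ_c(𝒢⁽⁰⁾, 𝒪)`, extended by zero to all arrows: it is generated by the
sections that are supported on a compact open subset of the unit space. -/
def gammaUnitSubgroup : AddSubgroup (Sections 𝒪) :=
  AddSubgroup.closure {f | ∃ U : Set (Arr X), U ⊆ unitArrows X ∧ IsCompactOpenBisection U ∧
    SupportedOn f U}

theorem gammaUnitSubgroup_le : gammaUnitSubgroup 𝒪 ≤ gammaSubgroup 𝒪 :=
  AddSubgroup.closure_mono fun _ ⟨U, _, hU, hf⟩ => ⟨U, hU, hf⟩

/-- The underlying type of `Γ_c(𝒢, 𝒪)`. -/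
def Gamma : Type (max u v w) := gammaSubgroup 𝒪

noncomputable instance : AddCommGroup (Gamma 𝒪) :=
  inferInstanceAs (AddCommGroup (gammaSubgroup 𝒪))

variable {𝒪}

theorem Out.arr_injective {x : X} : Function.Injective (Out.arr : Out x → Arr X) := by
  rintro ⟨y, γ⟩ ⟨z, β⟩ h
  simp only [Out.arr, Quiver.Total.mk.injEq, true_and] at h
  obtain ⟨rfl, h⟩ := h
  simp only [heq_eq_eq] at h
  rw [h]

/-- A section in `Γ_c(𝒢, 𝒪)` has only finitely many non-zero values on a fibre of the domain
map. -/
theorem finite_support {f : Sections 𝒪} (hf : f ∈ gammaSubgroup 𝒪) (x : X) :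
    {ρ : Out x | f ρ.arr ≠ 0}.Finite := by
  induction hf using AddSubgroup.closure_induction with
  | mem f hf =>
    obtain ⟨U, hU, -, h0⟩ := hf
    apply Set.Subsingleton.finite
    intro ρ hρ σ hσ
    apply Out.arr_injective
    have h1 : ρ.arr ∈ U := by by_contra h; exact hρ (h0 _ h)
    have h2 : σ.arr ∈ U := by by_contra h; exact hσ (h0 _ h)
    exact hU.injOn_dom h1 h2 rfl
  | zero => simp
  | add f g _ _ hf hg =>
    refine (hf.union hg).subset fun ρ hρ => ?_
    by_contra h
    simp only [Set.mem_union, Set.mem_ofPred_eq, not_or, not_not] at h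
    exact hρ (by simp [h.1, h.2])
  | neg f _ hf => simpa using hf

/-- The abelian group `𝓛_x`, the direct sum of the stalks `𝒪_{r(γ)}` over the arrows `γ` with
domain `x`; the element `a 1_γ` is `DirectSum.of _ γ a`. -/
abbrev Ell (𝒪 : GSheafOfRings.{u, v, w} X) (x : X) : Type (max u v w) :=
  ⨁ γ : Out x, 𝒪.stalk γ.1

open Classical in
/-- The restriction of an element of `Γ_c(𝒢, 𝒪)` to the fibre of the domain map over `x`. -/
noncomputable def res (x : X) : Gamma 𝒪 →+ Ell 𝒪 x where
  toFun f := DirectSum.mk (fun γ : Out x => 𝒪.stalk γ.1) (finite_support f.2 x).toFinset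
    fun ρ => f.1 ρ.1.arr
  map_zero' := by
    ext ρ
    by_cases h : ρ ∈ (finite_support (0 : Gamma 𝒪).2 x).toFinset
    · rw [DirectSum.mk_apply_of_mem h]; rfl
    · rw [DirectSum.mk_apply_of_notMem h]; rfl
  map_add' f g := by
    have key : ∀ (f : Gamma 𝒪) (ρ : Out x), DirectSum.mk (fun γ : Out x => 𝒪.stalk γ.1)
        (finite_support f.2 x).toFinset (fun ρ => f.1 ρ.1.arr) ρ = f.1 ρ.arr := by
      intro f ρ
      by_cases h : ρ ∈ (finite_support f.2 x).toFinset
      · rw [DirectSum.mk_apply_of_mem h]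
      · rw [DirectSum.mk_apply_of_notMem h]
        simp only [Set.Finite.mem_toFinset, Set.mem_ofPred_eq, not_not] at h
        exact h.symm
    ext ρ
    rw [DirectSum.add_apply, key, key, key]
    rfl

theorem res_apply (x : X) (f : Gamma 𝒪) (ρ : Out x) : res x f ρ = f.1 ρ.arr := by
  classical
  change DirectSum.mk (fun γ : Out x => 𝒪.stalk γ.1)
        (finite_support f.2 x).toFinset (fun ρ => f.1 ρ.1.arr) ρ = f.1 ρ.arr
  by_cases h : ρ ∈ (finite_support f.2 x).toFinset
  · rw [DirectSum.mk_apply_of_mem h]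
  · rw [DirectSum.mk_apply_of_notMem h]
    simp only [Set.Finite.mem_toFinset, Set.mem_ofPred_eq, not_not] at h
    exact h.symm

theorem Gamma.ext_res {f g : Gamma 𝒪} (h : ∀ x, res x f = res x g) : f = g := by
  apply Subtype.ext
  funext ⟨x, y, γ⟩
  have := congrArg (fun ξ : Ell 𝒪 x => ξ ⟨y, γ⟩) (h x)
  simpa only [res_apply] using this

open Classical in
/-- For `γ : x ⟶ y`, the biadditive map sending `∑ b_β 1_β ∈ 𝓛_y` and `a ∈ 𝒪_y` to
`∑ b_β α_β(a) 1_{βγ} ∈ 𝓛_x`. -/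
noncomputable def shift {x y : X} (γ : x ⟶ y) : Ell 𝒪 y →+ 𝒪.stalk y →+ Ell 𝒪 x :=
  DirectSum.toAddMonoid fun β : Out y =>
    { toFun := fun b => (DirectSum.of (fun γ : Out x => 𝒪.stalk γ.1) ⟨β.1, γ ≫ β.2⟩).comp
        ((AddMonoidHom.mulLeft b).comp (𝒪.act β.2).toAddMonoidHom)
      map_zero' := by ext a : 1; simp
      map_add' := fun b c => by ext a : 1; simp [add_mul] }

open Classical in
theorem shift_of {x y : X} (γ : x ⟶ y) (β : Out y) (b : 𝒪.stalk β.1) (a : 𝒪.stalk y) :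
    shift γ (DirectSum.of (fun γ : Out y => 𝒪.stalk γ.1) β b) a =
      DirectSum.of (fun γ : Out x => 𝒪.stalk γ.1) ⟨β.1, γ ≫ β.2⟩ (b * 𝒪.act β.2 a) := by
  simp [shift]

open Classical in
/-- The left action of `Γ_c(𝒢, 𝒪)` on `𝓛_x`, given by
`f • a 1_γ = ∑_{d(β) = r(γ)} f(β) α_β(a) 1_{βγ}`. -/
noncomputable def leftAct (x : X) : Gamma 𝒪 →+ Ell 𝒪 x →+ Ell 𝒪 x where
  toFun f := DirectSum.toAddMonoid fun γ : Out x => shift γ.2 (res γ.1 f)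
  map_zero' := by
    apply DirectSum.addHom_ext
    intro γ a
    simp
  map_add' f g := by
    apply DirectSum.addHom_ext
    intro γ a
    simp

open Classical in
theorem leftAct_of {x : X} (f : Gamma 𝒪) (γ : Out x) (a : 𝒪.stalk γ.1) :
    leftAct x f (DirectSum.of (fun γ : Out x => 𝒪.stalk γ.1) γ a) = shift γ.2 (res γ.1 f) a :=
  DirectSum.toAddMonoid_of _ _ _

open Classical in
theorem of_congr {x y : X} {γ β : x ⟶ y} (h : γ = β) (a : 𝒪.stalk y) :
    DirectSum.of (fun γ : Out x => 𝒪.stalk γ.1) ⟨y, γ⟩ a =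
      DirectSum.of (fun γ : Out x => 𝒪.stalk γ.1) ⟨y, β⟩ a := by
  rw [h]

theorem shift_shift {x y z : X} (γ : x ⟶ y) (β : y ⟶ z) (ξ : Ell 𝒪 z) (b : 𝒪.stalk z)
    (a : 𝒪.stalk y) :
    shift γ (shift β ξ b) a = shift (γ ≫ β) ξ (b * 𝒪.act β a) := by
  classical
  induction ξ using DirectSum.induction_on with
  | zero => simp
  | of δ c =>
    simp only [shift_of, 𝒪.act_comp, map_mul, mul_assoc]
    exact of_congr (Category.assoc _ _ _).symm _
  | add ξ η h1 h2 => simp only [map_add, AddMonoidHom.add_apply, h1, h2]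

theorem shift_leftAct {x y : X} (γ : x ⟶ y) (f : Gamma 𝒪) (ξ : Ell 𝒪 y) (a : 𝒪.stalk y) :
    shift γ (leftAct y f ξ) a = leftAct x f (shift γ ξ a) := by
  classical
  induction ξ using DirectSum.induction_on with
  | zero => simp
  | of δ c => rw [leftAct_of, shift_of, leftAct_of, shift_shift]
  | add ξ η h1 h2 => simp only [map_add, AddMonoidHom.add_apply, h1, h2]

theorem shift_apply {x y : X} (γ : x ⟶ y) (ξ : Ell 𝒪 y) (a : 𝒪.stalk y) (ζ : Out x) :
    shift γ ξ a ζ = ξ ⟨ζ.1, Groupoid.inv γ ≫ ζ.2⟩ * 𝒪.act (Groupoid.inv γ ≫ ζ.2) a := by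
  classical
  induction ξ using DirectSum.induction_on with
  | zero => simp
  | of δ c =>
    rw [shift_of]
    obtain ⟨z, δ⟩ := δ
    obtain ⟨z', ζ⟩ := ζ
    by_cases h : (⟨z', ζ⟩ : Out x) = ⟨z, γ ≫ δ⟩
    · obtain ⟨rfl, h⟩ := Sigma.mk.inj h
      obtain rfl := eq_of_heq h
      have h2 : Groupoid.inv γ ≫ γ ≫ δ = δ := by simp
      have h3 : ∀ ε : y ⟶ z', ε = δ → c * 𝒪.act δ a =
          DirectSum.of (fun γ : Out y => 𝒪.stalk γ.1) ⟨z', δ⟩ c ⟨z', ε⟩ * 𝒪.act ε a := by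
        rintro ε rfl
        rw [DirectSum.of_eq_same]
      rw [DirectSum.of_eq_same]
      exact h3 _ h2
    · rw [DirectSum.of_eq_of_ne _ _ _ h, DirectSum.of_eq_of_ne, zero_mul]
      intro h2
      apply h
      obtain ⟨rfl, h2⟩ := Sigma.mk.inj h2
      obtain rfl := eq_of_heq h2
      simp
  | add ξ η h1 h2 => simp only [map_add, AddMonoidHom.add_apply, DirectSum.add_apply, h1, h2, add_mul]

theorem leftAct_apply {x : X} (f : Gamma 𝒪) (ξ : Ell 𝒪 x) (ζ : Out x) :
    leftAct x f ξ ζ = ∑ᶠ ρ : Out x, f.1 ⟨ρ.1, ζ.1, Groupoid.inv ρ.2 ≫ ζ.2⟩ *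
      𝒪.act (Groupoid.inv ρ.2 ≫ ζ.2) (ξ ρ) := by
  classical
  have hfin : ∀ ξ : Ell 𝒪 x, (Function.support (M := 𝒪.stalk ζ.1) fun ρ : Out x =>
      (f.1 ⟨ρ.1, ζ.1, Groupoid.inv ρ.2 ≫ ζ.2⟩ *
        𝒪.act (Groupoid.inv ρ.2 ≫ ζ.2) (ξ ρ))).Finite := by
    intro ξ
    refine (DFinsupp.finite_support ξ).subset fun ρ hρ h => hρ ?_
    have h : ξ ρ = 0 := h
    simp [h]
  induction ξ using DirectSum.induction_on with
  | zero => simp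
  | of δ c =>
    rw [leftAct_of, shift_apply, finsum_eq_single _ δ, res_apply, DirectSum.of_eq_same]
    intro ρ hρ
    rw [DirectSum.of_eq_of_ne _ _ _ hρ]
    simp
  | add ξ η h1 h2 =>
    simp only [map_add, DirectSum.add_apply, mul_add, h1, h2]
    rw [← finsum_add_distrib (hfin ξ) (hfin η)]

end Convolution

/-! ### The convolution product is well defined -/

section Ring

variable {X : Type u} [Groupoid.{v} X] [TopologicalSpace X] [TopologicalSpace (Arr X)]
  {𝒪 : GSheafOfRings.{u, v, w} X}

/-- The product `UV` of two sets of arrows. -/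
def setMul (U V : Set (Arr X)) : Set (Arr X) :=
  {γ | ∃ ρ : Out γ.left, ρ.arr ∈ V ∧ (⟨ρ.1, γ.right, Groupoid.inv ρ.2 ≫ γ.hom⟩ : Arr X) ∈ U}

theorem conv_eq_of_mem {f g : Sections 𝒪} {V : Set (Arr X)} (hV : IsCompactOpenBisection V)
    (hg : SupportedOn g V) (γ : Arr X) (ρ : Out γ.left) (hρ : ρ.arr ∈ V) :
    conv f g γ = f ⟨ρ.1, γ.right, Groupoid.inv ρ.2 ≫ γ.hom⟩ *
      𝒪.act (Groupoid.inv ρ.2 ≫ γ.hom) (g ρ.arr) := by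
  apply finsum_eq_single
  intro σ hσ
  have : σ.arr ∉ V := fun h => hσ (Out.arr_injective (hV.injOn_dom h hρ rfl))
  rw [hg.2 _ this, map_zero, mul_zero]

theorem conv_eq_zero {f g : Sections 𝒪} {U V : Set (Arr X)}
    (hf : SupportedOn f U) (hg : SupportedOn g V) (γ : Arr X) (hγ : γ ∉ setMul U V) :
    conv f g γ = 0 := by
  apply finsum_eq_zero_of_forall_eq_zero
  intro ρ
  by_cases h : ρ.arr ∈ V
  · rw [hf.2 _ fun h' => hγ ⟨ρ, h, h'⟩, zero_mul]
  · rw [hg.2 _ h, map_zero, mul_zero]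

section Top

variable [IsAmpleGroupoid X]

theorem isOpenMap_dom : IsOpenMap (fun γ : Arr X => γ.left) := by
  have h : IsOpenMap (fun γ : Arr X => (⟨γ.right, γ.left, Groupoid.inv γ.hom⟩ : Arr X)) := by
    intro s hs
    have : (fun γ : Arr X => (⟨γ.right, γ.left, Groupoid.inv γ.hom⟩ : Arr X)) '' s =
        (fun γ : Arr X => (⟨γ.right, γ.left, Groupoid.inv γ.hom⟩ : Arr X)) ⁻¹' s :=
      congrFun (Set.image_eq_preimage_of_inverse (fun γ => by simp) (fun γ => by simp)) s
    rw [this]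
    exact hs.preimage IsAmpleGroupoid.continuous_inv
  exact (IsAmpleGroupoid.isLocalHomeomorph_range (X := X)).isOpenMap.comp h

/-- The domain of definition of the local section of the domain map given by `V`. -/
def liftDom (V : Set (Arr X)) : Set (Arr X) := {γ | ∃ ρ : Out γ.left, ρ.arr ∈ V}

theorem continuousOn_lift {V : Set (Arr X)} (hV : IsCompactOpenBisection V)
    (σ : ∀ γ : Arr X, Out γ.left) (hσ : ∀ γ ∈ liftDom V, (σ γ).arr ∈ V) :
    IsOpen (liftDom V) ∧ ContinuousOn (fun γ => (σ γ).arr) (liftDom V) := by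
  have key : ∀ W : Set (Arr X), (liftDom V ∩ (fun γ => (σ γ).arr) ⁻¹' W) =
      (fun γ : Arr X => γ.left) ⁻¹' ((fun γ : Arr X => γ.left) '' (V ∩ W)) := by
    intro W
    ext γ
    constructor
    · rintro ⟨h1, h2⟩
      exact ⟨(σ γ).arr, ⟨hσ γ h1, h2⟩, rfl⟩
    · rintro ⟨ρ, ⟨h1, h2⟩, h3⟩
      obtain ⟨x, y, ρ⟩ := ρ
      obtain ⟨x', z, γ⟩ := γ
      dsimp only at h3
      subst h3
      have hγ : (⟨x, z, γ⟩ : Arr X) ∈ liftDom V := ⟨⟨y, ρ⟩, h1⟩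
      refine ⟨hγ, ?_⟩
      have := hV.injOn_dom (hσ _ hγ) h1 rfl
      simp only [Set.mem_preimage]
      rw [this]
      exact h2
  have hop : ∀ W : Set (Arr X), IsOpen W →
      IsOpen (liftDom V ∩ (fun γ => (σ γ).arr) ⁻¹' W) := fun W hW => by
    rw [key]
    exact (isOpenMap_dom _ (hV.isOpen.inter hW)).preimage IsAmpleGroupoid.continuous_dom
  have h0 : IsOpen (liftDom V) := by simpa using hop Set.univ isOpen_univ
  refine ⟨h0, ?_⟩
  rw [continuousOn_open_iff h0]
  exact fun W hW => hop W hW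

theorem continuousOn_quot {D : Set (Arr X)} (σ : ∀ γ : Arr X, Out γ.left)
    (h : ContinuousOn (fun γ => (σ γ).arr) D) :
    ContinuousOn (fun γ : Arr X =>
      (⟨(σ γ).1, γ.right, Groupoid.inv (σ γ).2 ≫ γ.hom⟩ : Arr X)) D := by
  have h2 : ContinuousOn (fun γ : Arr X =>
      (⟨Groupoid.inv (σ γ).2, γ.hom⟩ : ComposablePair X)) D := by
    have hi : Topology.IsInducing (fun p : ComposablePair X =>
        ((⟨p.dom, p.mid, p.first⟩ : Arr X), (⟨p.mid, p.cod, p.second⟩ : Arr X))) := ⟨rfl⟩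
    rw [hi.continuousOn_iff]
    exact (IsAmpleGroupoid.continuous_inv.comp_continuousOn h).prodMk continuousOn_id
  exact IsAmpleGroupoid.continuous_comp.comp_continuousOn h2

theorem exists_lift (V : Set (Arr X)) :
    ∃ σ : ∀ γ : Arr X, Out γ.left, ∀ γ ∈ liftDom V, (σ γ).arr ∈ V := by
  classical
  refine ⟨fun γ => if h : ∃ ρ : Out γ.left, ρ.arr ∈ V then h.choose else ⟨γ.left, 𝟙 _⟩, ?_⟩
  intro γ hγ
  have h : ∃ ρ : Out γ.left, ρ.arr ∈ V := hγ
  simp only [h, dite_true]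
  exact h.choose_spec

theorem setMul_eq {U V : Set (Arr X)} (hV : IsCompactOpenBisection V)
    (σ : ∀ γ : Arr X, Out γ.left) (hσ : ∀ γ ∈ liftDom V, (σ γ).arr ∈ V) :
    setMul U V = liftDom V ∩ (fun γ : Arr X =>
      (⟨(σ γ).1, γ.right, Groupoid.inv (σ γ).2 ≫ γ.hom⟩ : Arr X)) ⁻¹' U := by
  ext γ
  constructor
  · rintro ⟨ρ, h1, h2⟩
    have hγ : γ ∈ liftDom V := ⟨ρ, h1⟩
    have : σ γ = ρ := Out.arr_injective (hV.injOn_dom (hσ _ hγ) h1 rfl)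
    refine ⟨hγ, ?_⟩
    change (⟨(σ γ).1, γ.right, Groupoid.inv (σ γ).2 ≫ γ.hom⟩ : Arr X) ∈ U
    rw [this]
    exact h2
  · rintro ⟨h1, h2⟩
    exact ⟨σ γ, hσ _ h1, h2⟩

theorem isCompactOpenBisection_setMul {U V : Set (Arr X)} (hU : IsCompactOpenBisection U)
    (hV : IsCompactOpenBisection V) : IsCompactOpenBisection (setMul U V) := by
  obtain ⟨σ, hσ⟩ := exists_lift V
  obtain ⟨hD, hc⟩ := continuousOn_lift hV σ hσ
  refine ⟨?_, ?_, ?_, ?_⟩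
  · rw [setMul_eq hV σ hσ]
    exact (continuousOn_quot σ hc).isOpen_inter_preimage hD hU.isOpen
  · have hi : Topology.IsInducing (fun p : ComposablePair X =>
        ((⟨p.dom, p.mid, p.first⟩ : Arr X), (⟨p.mid, p.cod, p.second⟩ : Arr X))) := ⟨rfl⟩
    have hT2 : T2Space X := IsAmpleGroupoid.t2
    have hK : IsCompact ((V ×ˢ U) ∩ {q : Arr X × Arr X | q.1.right = q.2.left}) := by
      refine (hV.isCompact.prod hU.isCompact).inter_right (isClosed_eq ?_ ?_)
      · exact (IsAmpleGroupoid.isLocalHomeomorph_range (X := X)).continuous.comp continuous_fst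
      · exact (IsAmpleGroupoid.continuous_dom (X := X)).comp continuous_snd
    rw [← hi.isCompact_preimage_iff] at hK
    · have := hK.image IsAmpleGroupoid.continuous_comp
      convert this using 1
      ext γ
      constructor
      · rintro ⟨ρ, h1, h2⟩
        exact ⟨⟨ρ.2, Groupoid.inv ρ.2 ≫ γ.hom⟩, ⟨⟨h1, h2⟩, rfl⟩, by simp⟩
      · rintro ⟨p, ⟨⟨h1, h2⟩, -⟩, rfl⟩
        refine ⟨⟨p.mid, p.first⟩, h1, ?_⟩
        simpa using h2
    · rintro ⟨⟨x, y, ρ⟩, ⟨y', z, β⟩⟩ ⟨-, h⟩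
      replace h : y = y' := h
      subst h
      exact ⟨⟨ρ, β⟩, rfl⟩
  · rintro ⟨x, z, γ⟩ ⟨⟨y, ρ⟩, h1, h2⟩ ⟨x', z', γ'⟩ ⟨⟨y', ρ'⟩, h1', h2'⟩ h
    dsimp only at h
    subst h
    obtain ⟨rfl, h⟩ := Sigma.mk.inj (Out.arr_injective (hV.injOn_dom h1 h1' rfl))
    obtain rfl := eq_of_heq h
    obtain ⟨rfl, h⟩ := Sigma.mk.inj (Out.arr_injective (x := y)
      (a₁ := ⟨z, Groupoid.inv ρ ≫ γ⟩) (a₂ := ⟨z', Groupoid.inv ρ ≫ γ'⟩)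
      (hU.injOn_dom h2 h2' rfl))
    have h := eq_of_heq h
    rw [cancel_epi] at h
    rw [h]
  · rintro ⟨x, z, γ⟩ ⟨⟨y, ρ⟩, h1, h2⟩ ⟨x', z', γ'⟩ ⟨⟨y', ρ'⟩, h1', h2'⟩ h
    dsimp only at h
    subst h
    have h3 := hU.injOn_range h2 h2' rfl
    have h4 : y = y' := congrArg Quiver.Total.left h3
    subst h4
    have h5 := hV.injOn_range h1 h1' rfl
    have h6 : x = x' := congrArg Quiver.Total.left h5
    subst h6
    simp only [Out.arr, Quiver.Total.mk.injEq, heq_eq_eq, true_and] at h3 h5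
    subst h5
    rw [cancel_epi] at h3
    rw [h3]

theorem supportedOn_conv {f g : Sections 𝒪} {U V : Set (Arr X)}
    (hV : IsCompactOpenBisection V)
    (hf : SupportedOn f U) (hg : SupportedOn g V) : SupportedOn (conv f g) (setMul U V) := by
  refine ⟨?_, fun γ hγ => conv_eq_zero hf hg γ hγ⟩
  obtain ⟨σ, hσ⟩ := exists_lift V
  obtain ⟨hD, hc⟩ := continuousOn_lift hV σ hσ
  have hq := continuousOn_quot σ hc
  have hsub : setMul U V ⊆ liftDom V := fun γ ⟨ρ, h, _⟩ => ⟨ρ, h⟩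
  have hmem : ∀ γ ∈ setMul U V,
      (⟨(σ γ).1, γ.right, Groupoid.inv (σ γ).2 ≫ γ.hom⟩ : Arr X) ∈ U := by
    intro γ hγ
    rw [setMul_eq hV σ hσ] at hγ
    exact hγ.2
  have hcf : ContinuousOn (fun γ : Arr X =>
      toSpace f ⟨(σ γ).1, γ.right, Groupoid.inv (σ γ).2 ≫ γ.hom⟩) (setMul U V) :=
    hf.1.comp (hq.mono hsub) hmem
  have hcg : ContinuousOn (fun γ : Arr X => toSpace g (σ γ).arr) (setMul U V) :=
    hg.1.comp (hc.mono hsub) fun γ hγ => hσ _ (hsub hγ)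
  have hca : ContinuousOn (fun γ : Arr X => (⟨γ.right, 𝒪.act (Groupoid.inv (σ γ).2 ≫ γ.hom)
      (g (σ γ).arr)⟩ : Σ x, 𝒪.stalk x)) (setMul U V) := by
    have : ContinuousOn (fun γ : Arr X => (⟨Groupoid.inv (σ γ).2 ≫ γ.hom, g (σ γ).arr⟩ :
        ActPair 𝒪.stalk)) (setMul U V) := by
      have hi : Topology.IsInducing (fun p : ActPair 𝒪.stalk =>
        ((⟨p.dom, p.cod, p.arrow⟩ : Arr X), (⟨p.dom, p.val⟩ : Σ x, 𝒪.stalk x))) := ⟨rfl⟩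
      rw [hi.continuousOn_iff]
      exact (hq.mono hsub).prodMk hcg
    exact 𝒪.continuous_act.comp_continuousOn this
  have hfin : ContinuousOn (fun γ : Arr X =>
      (⟨γ.right, f ⟨(σ γ).1, γ.right, Groupoid.inv (σ γ).2 ≫ γ.hom⟩ *
        𝒪.act (Groupoid.inv (σ γ).2 ≫ γ.hom) (g (σ γ).arr)⟩ : Σ x, 𝒪.stalk x))
      (setMul U V) := by
    have : ContinuousOn (fun γ : Arr X =>
        (⟨f ⟨(σ γ).1, γ.right, Groupoid.inv (σ γ).2 ≫ γ.hom⟩,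
          𝒪.act (Groupoid.inv (σ γ).2 ≫ γ.hom) (g (σ γ).arr)⟩ : FibrePair 𝒪.stalk))
        (setMul U V) := by
      have hi : Topology.IsInducing (fun p : FibrePair 𝒪.stalk =>
        ((⟨p.pt, p.fst⟩ : Σ x, 𝒪.stalk x), (⟨p.pt, p.snd⟩ : Σ x, 𝒪.stalk x))) := ⟨rfl⟩
      rw [hi.continuousOn_iff]
      exact hcf.prodMk hca
    exact 𝒪.continuous_mul.comp_continuousOn this
  refine hfin.congr fun γ hγ => ?_
  simp only [toSpace]
  rw [conv_eq_of_mem hV hg γ (σ γ) (hσ _ (hsub hγ))]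

theorem setMul_subset_unitArrows {U V : Set (Arr X)} (hU : U ⊆ unitArrows X)
    (hV : V ⊆ unitArrows X) : setMul U V ⊆ unitArrows X := by
  rintro ⟨x, z, γ⟩ ⟨⟨y, ρ⟩, h1, h2⟩
  obtain ⟨a, ha⟩ := hV h1
  obtain ⟨b, hb⟩ := hU h2
  simp only [Out.arr, Quiver.Total.mk.injEq] at ha hb
  obtain ⟨rfl, rfl, ha⟩ := ha
  obtain ⟨rfl, rfl, hb⟩ := hb
  obtain rfl := eq_of_heq ha
  refine ⟨b, ?_⟩
  have hb := eq_of_heq hb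
  rw [Groupoid.inv_eq_inv, IsIso.inv_id, Category.id_comp] at hb
  rw [← hb]

end Top

theorem conv_add_left {f₁ f₂ g : Sections 𝒪} (hg : g ∈ gammaSubgroup 𝒪) :
    conv (f₁ + f₂) g = conv f₁ g + conv f₂ g := by
  funext γ
  have hfin : ∀ f : Sections 𝒪, (Function.support (M := 𝒪.stalk γ.right) fun ρ : Out γ.left =>
      (f ⟨ρ.1, γ.right, Groupoid.inv ρ.2 ≫ γ.hom⟩ *
        𝒪.act (Groupoid.inv ρ.2 ≫ γ.hom) (g ρ.arr))).Finite := fun f =>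
    (finite_support hg γ.left).subset fun ρ hρ h => hρ (by simp [h])
  simp only [conv, Pi.add_apply, add_mul]
  exact finsum_add_distrib (hfin f₁) (hfin f₂)

theorem conv_add_right {f g₁ g₂ : Sections 𝒪} (hg₁ : g₁ ∈ gammaSubgroup 𝒪)
    (hg₂ : g₂ ∈ gammaSubgroup 𝒪) : conv f (g₁ + g₂) = conv f g₁ + conv f g₂ := by
  funext γ
  have hfin : ∀ g ∈ gammaSubgroup 𝒪, (Function.support (M := 𝒪.stalk γ.right) fun ρ : Out γ.left =>
      (f ⟨ρ.1, γ.right, Groupoid.inv ρ.2 ≫ γ.hom⟩ *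
        𝒪.act (Groupoid.inv ρ.2 ≫ γ.hom) (g ρ.arr))).Finite := fun g hg =>
    (finite_support hg γ.left).subset fun ρ hρ h => hρ (by simp [h])
  simp only [conv, Pi.add_apply, map_add, mul_add]
  exact finsum_add_distrib (hfin g₁ hg₁) (hfin g₂ hg₂)

theorem conv_zero_left (g : Sections 𝒪) : conv 0 g = 0 := by
  funext γ; simp [conv]

theorem conv_zero_right (f : Sections 𝒪) : conv f 0 = 0 := by
  funext γ; simp [conv]

theorem conv_neg_left (f g : Sections 𝒪) : conv (-f) g = -conv f g := by
  funext γ; simp [conv, finsum_neg_distrib]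

theorem conv_neg_right (f g : Sections 𝒪) : conv f (-g) = -conv f g := by
  funext γ; simp [conv, finsum_neg_distrib]

variable [IsAmpleGroupoid X]

theorem conv_mem {f g : Sections 𝒪} (hf : f ∈ gammaSubgroup 𝒪) (hg : g ∈ gammaSubgroup 𝒪) :
    conv f g ∈ gammaSubgroup 𝒪 := by
  induction hf using AddSubgroup.closure_induction with
  | mem f hf =>
    obtain ⟨U, hU, hfU⟩ := hf
    induction hg using AddSubgroup.closure_induction with
    | mem g hg =>
      obtain ⟨V, hV, hgV⟩ := hg
      exact AddSubgroup.subset_closure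
        ⟨_, isCompactOpenBisection_setMul hU hV, supportedOn_conv hV hfU hgV⟩
    | zero => rw [conv_zero_right]; exact zero_mem _
    | add g h hg hh h1 h2 => rw [conv_add_right hg hh]; exact add_mem h1 h2
    | neg g _ h => rw [conv_neg_right]; exact neg_mem h
  | zero => rw [conv_zero_left]; exact zero_mem _
  | add f h _ _ h1 h2 => rw [conv_add_left hg]; exact add_mem h1 h2
  | neg f _ h => rw [conv_neg_left]; exact neg_mem h

theorem conv_mem_unit {f g : Sections 𝒪} (hf : f ∈ gammaUnitSubgroup 𝒪)
    (hg : g ∈ gammaUnitSubgroup 𝒪) : conv f g ∈ gammaUnitSubgroup 𝒪 := by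
  induction hf using AddSubgroup.closure_induction with
  | mem f hf =>
    obtain ⟨U, hU₀, hU, hfU⟩ := hf
    induction hg using AddSubgroup.closure_induction with
    | mem g hg =>
      obtain ⟨V, hV₀, hV, hgV⟩ := hg
      exact AddSubgroup.subset_closure ⟨_, setMul_subset_unitArrows hU₀ hV₀,
        isCompactOpenBisection_setMul hU hV, supportedOn_conv hV hfU hgV⟩
    | zero => rw [conv_zero_right]; exact zero_mem _
    | add g h hg hh h1 h2 =>
      rw [conv_add_right (gammaUnitSubgroup_le 𝒪 hg) (gammaUnitSubgroup_le 𝒪 hh)]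
      exact add_mem h1 h2
    | neg g _ h => rw [conv_neg_right]; exact neg_mem h
  | zero => rw [conv_zero_left]; exact zero_mem _
  | add f h _ _ h1 h2 =>
    rw [conv_add_left (gammaUnitSubgroup_le 𝒪 hg)]; exact add_mem h1 h2
  | neg f _ h => rw [conv_neg_left]; exact neg_mem h

noncomputable instance : Mul (Gamma 𝒪) := ⟨fun f g => ⟨conv f.1 g.1, conv_mem f.2 g.2⟩⟩

theorem res_mul (x : X) (f g : Gamma 𝒪) : res x (f * g) = leftAct x f (res x g) := by
  ext ζ
  rw [res_apply, leftAct_apply]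
  simp only [res_apply]
  rfl

theorem leftAct_mul (x : X) (f g : Gamma 𝒪) :
    leftAct x (f * g) = (leftAct x f).comp (leftAct x g) := by
  classical
  apply DirectSum.addHom_ext
  intro γ a
  rw [AddMonoidHom.comp_apply, leftAct_of, leftAct_of, res_mul, shift_leftAct]

/-- The ring `Γ_c(𝒢, 𝒪)` under pointwise addition and convolution (in general without unit). -/
noncomputable instance : NonUnitalRing (Gamma 𝒪) where
  __ := (inferInstance : AddCommGroup (Gamma 𝒪))
  mul := (· * ·)
  left_distrib f g h := Subtype.ext (conv_add_right g.2 h.2)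
  right_distrib f g h := Subtype.ext (conv_add_left h.2)
  zero_mul f := Subtype.ext (conv_zero_left _)
  mul_zero f := Subtype.ext (conv_zero_right _)
  mul_assoc f g h := Gamma.ext_res fun x => by
    rw [res_mul, res_mul, res_mul, leftAct_mul]; rfl

variable (𝒪)

/-- The diagonal subring `Γ_c(𝒢⁽⁰⁾, 𝒪)` of `Γ_c(𝒢, 𝒪)`. -/
noncomputable def gammaUnit : NonUnitalSubring (Gamma 𝒪) where
  carrier := {f | f.1 ∈ gammaUnitSubgroup 𝒪}
  add_mem' := fun hf hg => (gammaUnitSubgroup 𝒪).add_mem hf hg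
  zero_mem' := zero_mem (gammaUnitSubgroup 𝒪)
  neg_mem' := fun hf => (gammaUnitSubgroup 𝒪).neg_mem hf
  mul_mem' := fun hf hg => conv_mem_unit hf hg

end Ring

/-! ### Modules over rings without unit -/

section Modules

/-- A subring is maximal commutative if it is maximal among the commutative subrings. -/
def IsMaximalCommutative {R : Type u} [NonUnitalRing R] (S : NonUnitalSubring R) : Prop :=
  Maximal (fun T : NonUnitalSubring R => ∀ a ∈ T, ∀ b ∈ T, a * b = b * a) S

variable {R : Type u} [NonUnitalRing R] {M : Type t} [AddCommGroup M]

/-! A left module over a ring `R` without unit is an abelian group `M` together with a ring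
homomorphism `ρ : R →ₙ+* AddMonoid.End M`; here `ρ r m` is `r • m`. -/

/-- Submodules: subgroups that are stable under the action. -/
def IsSubmodule (ρ : R →ₙ+* AddMonoid.End M) (N : AddSubgroup M) : Prop :=
  ∀ r : R, ∀ m ∈ N, ρ r m ∈ N

/-- The submodule `N` is simple: `RN ≠ 0` and `N` has no submodules other than `0` and `N`. -/
def IsSimpleSubmodule (ρ : R →ₙ+* AddMonoid.End M) (N : AddSubgroup M) : Prop :=
  IsSubmodule ρ N ∧ (∃ r : R, ∃ m ∈ N, ρ r m ≠ 0) ∧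
    ∀ K : AddSubgroup M, IsSubmodule ρ K → K ≤ N → K = ⊥ ∨ K = N

/-- Simple modules. -/
def IsSimple (ρ : R →ₙ+* AddMonoid.End M) : Prop := IsSimpleSubmodule ρ ⊤

/-- Semisimple modules: sums of simple submodules. -/
def IsSemisimple (ρ : R →ₙ+* AddMonoid.End M) : Prop :=
  sSup {N : AddSubgroup M | IsSimpleSubmodule ρ N} = ⊤

/-- Faithful modules: only `0` annihilates the module. -/
def IsFaithful (ρ : R →ₙ+* AddMonoid.End M) : Prop :=
  ∀ r : R, (∀ m : M, ρ r m = 0) → r = 0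

variable (R)

/-- The Jacobson radical of a ring that need not have a unit: the elements that annihilate every
simple left module.  (Up to isomorphism every simple module is a quotient of the additive group
of `R`, so that it suffices to look at the universe of `R`.) -/
def jacobsonRadical : Set R :=
  {a | ∀ (M : Type u) [AddCommGroup M] (ρ : R →ₙ+* AddMonoid.End M), IsSimple ρ →
    ∀ m : M, ρ a m = 0}

/-- A ring is semiprimitive if its Jacobson radical is zero. -/
def IsSemiprimitive : Prop := jacobsonRadical R = {0}

/-- The direct sum of a family of modules. -/
noncomputable def directSumModule {R : Type u} [NonUnitalRing R] {ι : Type v} {M : ι → Type t}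
    [∀ i, AddCommGroup (M i)] (ρ : ∀ i, R →ₙ+* AddMonoid.End (M i)) :
    R →ₙ+* AddMonoid.End (⨁ i, M i) where
  toFun r := DirectSum.map fun i => ρ i r
  map_zero' := by
    refine AddMonoidHom.ext fun m => DFinsupp.ext fun i => ?_
    refine (DirectSum.map_apply _ _ _).trans ?_
    rw [map_zero]; rfl
  map_add' r s := by
    refine AddMonoidHom.ext fun m => DFinsupp.ext fun i => ?_
    refine (DirectSum.map_apply _ _ _).trans ?_
    rw [map_add]; rfl
  map_mul' r s := by
    refine AddMonoidHom.ext fun m => DFinsupp.ext fun i => ?_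
    refine (DirectSum.map_apply _ _ _).trans ?_
    rw [map_mul]; rfl

end Modules

/-! ### Induced modules -/

section Induction

variable {X : Type u} [Groupoid.{v} X] [TopologicalSpace X] [TopologicalSpace (Arr X)]
  (𝒪 : GSheafOfRings.{u, v, w} X)

/-- The isotropy group at `x` acts on the stalk at `x`. In `End x` the product `β * γ` is
`γ ≫ β`. -/
instance isotropyAction (x : X) : MulSemiringAction (End x) (𝒪.stalk x) where
  smul γ a := 𝒪.act γ a
  one_smul a := 𝒪.act_id x a
  mul_smul β γ a := 𝒪.act_comp γ β a
  smul_zero γ := map_zero (𝒪.act γ)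
  smul_add γ := map_add (𝒪.act γ)
  smul_one γ := map_one (𝒪.act γ)
  smul_mul γ := map_mul (𝒪.act γ)

/-- The isotropy skew group ring `B_x = 𝒪_x ⋊ 𝒢_x^x`, in which `aδ · bη = a α_δ(b) δη`. -/
abbrev IsotropyRing (x : X) : Type (max v w) := SkewMonoidAlgebra (𝒪.stalk x) (End x)

variable {𝒪}

open Classical in
/-- The right action on `𝓛_x` of an element `bδ` of `B_x`: `a 1_γ · bδ = a α_γ(b) 1_{γδ}`. -/
noncomputable def rightActSingle (x : X) (δ : End x) :
    𝒪.stalk x →+ Ell 𝒪 x →+ Ell 𝒪 x where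
  toFun b := DirectSum.toAddMonoid fun γ : Out x =>
    (DirectSum.of (fun γ : Out x => 𝒪.stalk γ.1) ⟨γ.1, (show x ⟶ x from δ) ≫ γ.2⟩).comp
      (AddMonoidHom.mulRight (𝒪.act γ.2 b))
  map_zero' := by
    apply DirectSum.addHom_ext
    intro γ a
    simp
  map_add' b c := by
    apply DirectSum.addHom_ext
    intro γ a
    simp [mul_add]

/-- The right action of `B_x` on `𝓛_x`; `rightAct x b l` is `l · b`. -/
noncomputable def rightAct (x : X) : IsotropyRing 𝒪 x →+ Ell 𝒪 x →+ Ell 𝒪 x :=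
  (Finsupp.liftAddHom (rightActSingle x)).comp
    (SkewMonoidAlgebra.coeffAddEquiv (k := 𝒪.stalk x) (G := End x)).toAddMonoidHom

theorem rightAct_single (x : X) (δ : End x) (b : 𝒪.stalk x) :
    rightAct x (SkewMonoidAlgebra.single δ b) = rightActSingle x δ b := by
  simp [rightAct, SkewMonoidAlgebra.coeffAddEquiv]

open Classical in
theorem rightActSingle_of (x : X) (δ : End x) (b : 𝒪.stalk x) (γ : Out x) (a : 𝒪.stalk γ.1) :
    rightActSingle x δ b (DirectSum.of (fun γ : Out x => 𝒪.stalk γ.1) γ a) =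
      DirectSum.of (fun γ : Out x => 𝒪.stalk γ.1) ⟨γ.1, (show x ⟶ x from δ) ≫ γ.2⟩
        (a * 𝒪.act γ.2 b) :=
  DirectSum.toAddMonoid_of _ _ _

theorem rightActSingle_shift {x y : X} (δ : End x) (b : 𝒪.stalk x) (γ : x ⟶ y) (ξ : Ell 𝒪 y)
    (a : 𝒪.stalk y) :
    rightActSingle x δ b (shift γ ξ a) =
      shift ((show x ⟶ x from δ) ≫ γ) ξ (a * 𝒪.act γ b) := by
  classical
  induction ξ using DirectSum.induction_on with
  | zero => simp
  | of β c =>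
    rw [shift_of, shift_of, rightActSingle_of]
    simp only [𝒪.act_comp, map_mul, mul_assoc]
    exact of_congr (Category.assoc _ _ _).symm _
  | add ξ η h1 h2 => simp only [map_add, AddMonoidHom.add_apply, h1, h2]

/-- The left action of `Γ_c(𝒢, 𝒪)` on `𝓛_x` commutes with the right action of `B_x`. -/
theorem leftAct_rightAct (x : X) (f : Gamma 𝒪) (b : IsotropyRing 𝒪 x) (l : Ell 𝒪 x) :
    leftAct x f (rightAct x b l) = rightAct x b (leftAct x f l) := by
  classical
  induction b using SkewMonoidAlgebra.induction_on with
  | zero => simp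
  | single δ b =>
    rw [rightAct_single]
    induction l using DirectSum.induction_on with
    | zero => simp
    | of γ a => rw [rightActSingle_of, leftAct_of, leftAct_of, rightActSingle_shift]
    | add l m h1 h2 => simp only [map_add, h1, h2]
  | add b c h1 h2 => simp only [map_add, AddMonoidHom.add_apply, h1, h2]

variable (𝒪)

/-- The relations `l·b ⊗ m = l ⊗ b·m` that define `𝓛_x ⊗_{B_x} M` as a quotient of
`𝓛_x ⊗_ℤ M`. -/
def balanced (x : X) (M : Type t) [AddCommGroup M] [Module (IsotropyRing 𝒪 x) M] :
    AddSubgroup (Ell 𝒪 x ⊗[ℤ] M) :=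
  AddSubgroup.closure {z | ∃ (l : Ell 𝒪 x) (b : IsotropyRing 𝒪 x) (m : M),
    z = rightAct x b l ⊗ₜ[ℤ] m - l ⊗ₜ[ℤ] (b • m)}

/-- The abelian group `Ind_x(M) = 𝓛_x ⊗_{B_x} M`. -/
abbrev Ind (x : X) (M : Type t) [AddCommGroup M] [Module (IsotropyRing 𝒪 x) M] :
    Type (max u v w t) :=
  (Ell 𝒪 x ⊗[ℤ] M) ⧸ balanced 𝒪 x M

theorem balanced_le (x : X) (M : Type t) [AddCommGroup M] [Module (IsotropyRing 𝒪 x) M]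
    (f : Gamma 𝒪) : balanced 𝒪 x M ≤ (balanced 𝒪 x M).comap
      (LinearMap.rTensor M (AddMonoidHom.toIntLinearMap (leftAct x f))).toAddMonoidHom := by
  rw [balanced, AddSubgroup.closure_le]
  rintro _ ⟨l, b, m, rfl⟩
  apply AddSubgroup.subset_closure
  refine ⟨leftAct x f l, b, m, ?_⟩
  simp only [LinearMap.toAddMonoidHom_coe, map_sub, LinearMap.rTensor_tmul,
    AddMonoidHom.coe_toIntLinearMap, leftAct_rightAct]

variable [IsAmpleGroupoid X]

/-- The induced module: `Γ_c(𝒢, 𝒪)` acts on `Ind_x(M)` by `f • (l ⊗ m) = (f • l) ⊗ m`. -/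
noncomputable def indModule (x : X) (M : Type t) [AddCommGroup M]
    [Module (IsotropyRing 𝒪 x) M] : Gamma 𝒪 →ₙ+* AddMonoid.End (Ind 𝒪 x M) where
  toFun f := QuotientAddGroup.map _ _
    (LinearMap.rTensor M (AddMonoidHom.toIntLinearMap (leftAct x f))).toAddMonoidHom
    (balanced_le 𝒪 x M f)
  map_zero' := by
    apply QuotientAddGroup.addMonoidHom_ext
    ext z
    induction z using TensorProduct.induction_on with
    | zero => simp
    | tmul l m => simp; rfl
    | add z w h1 h2 =>
      exact (map_add _ z w).trans ((congrArg₂ _ h1 h2).trans (map_add _ z w).symm)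
  map_add' f g := by
    apply QuotientAddGroup.addMonoidHom_ext
    ext z
    induction z using TensorProduct.induction_on with
    | zero => simp
    | tmul l m => simp [TensorProduct.add_tmul]; rfl
    | add z w h1 h2 =>
      exact (map_add _ z w).trans ((congrArg₂ _ h1 h2).trans (map_add _ z w).symm)
  map_mul' f g := by
    apply QuotientAddGroup.addMonoidHom_ext
    ext z
    induction z using TensorProduct.induction_on with
    | zero => simp
    | tmul l m => simp [leftAct_mul]; rfl
    | add z w h1 h2 =>
      exact (map_add _ z w).trans ((congrArg₂ _ h1 h2).trans (map_add _ z w).symm)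

end Induction

end SheafAlgebra

/-! Write $D$ for the diagonal subring $\Gamma_c(\mathscr G^{(0)},\mathcal O)$. Faithfulness is
reduced to $D$: the annihilator $I$ of $\bigoplus_x\mathrm{Ind}_x(M_x)$ is a two-sided ideal, and it
is shown that $I\cap D=0$ and that a two-sided ideal meeting $D$ only in zero is itself zero.

For $f\in D$ and $f(x)\neq0$, let $b$ be the inverse of $f(x)$ in the field $\mathcal O_x$. Then $f$
maps $b1_x\otimes m$ to $1_x\otimes m$, which is nonzero for $m\neq 0$ because projecting $\mathcal
L_x$ onto $B_x$ induces a map $\mathrm{Ind}_x(M)\to M$ that recovers $m$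
(`apply_unit_eq_zero_of_annihilates`). Hence an element of $I\cap D$ vanishes at every unit.

The second fact (`eq_zero_of_mem_ideal`) is an induction on the number $n$ of summands when $f\in I$
is written as a sum of sections supported on compact open bisections. If $f(\gamma)\neq0$, a right
factor moves this value to the unit $y=r(\gamma)$. Some summand $k$ is then nonzero at $y$, and a
further right factor $e\in D$ concentrated near $y$ makes $ke$ diagonal while keeping the value at
$y$. The resulting $p\in I$ is $ke$ plus $n-1$ bisectional terms. For a generator $a$ of $D$ the
commutator $[a,p]$ loses the term $ke$, since $D$ is commutative, and commutation with $a$ does not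
enlarge supports; so $[a,p]\in I$ is a sum of $n-1$ bisectional terms and vanishes by induction.
Thus $p$ commutes with $D$, maximality gives $p\in I\cap D=0$, and this contradicts
$p(y)=f(\gamma)\neq0$.

Semisimplicity follows since each $\mathrm{Ind}_x(M)$ is simple (`isSimple_indModule`): diagonal
elements separate the ranges of arrows, so a nonzero submodule contains some nonzero
$1_\gamma\otimes m$, hence $\mathcal L_x\otimes m$, and the $m$ with this property form a nonzero
$B_x$-submodule of $M$. Semiprimitivity follows because every $B_x$ has a simple module and the
Jacobson radical kills the simple modules $\mathrm{Ind}_x(M_x)$. -/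

namespace SheafAlgebra

/-! ### Continuity of the stalkwise operations -/

section Stalkwise

variable {X : Type u} [Groupoid.{v} X] [TopologicalSpace X] [TopologicalSpace (Arr X)]
  {𝒪 : GSheafOfRings.{u, v, w} X}

theorem continuousOn_stalk_add {Z : Type t} [TopologicalSpace Z] {D : Set Z} {g : Z → X}
    {a b : ∀ z, 𝒪.stalk (g z)}
    (ha : ContinuousOn (fun z => (⟨g z, a z⟩ : Σ x, 𝒪.stalk x)) D)
    (hb : ContinuousOn (fun z => (⟨g z, b z⟩ : Σ x, 𝒪.stalk x)) D) :
    ContinuousOn (fun z => (⟨g z, a z + b z⟩ : Σ x, 𝒪.stalk x)) D := by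
  have hi : Topology.IsInducing (fun p : FibrePair 𝒪.stalk =>
    ((⟨p.pt, p.fst⟩ : Σ x, 𝒪.stalk x), (⟨p.pt, p.snd⟩ : Σ x, 𝒪.stalk x))) := ⟨rfl⟩
  have : ContinuousOn (fun z => (⟨a z, b z⟩ : FibrePair 𝒪.stalk)) D := by
    rw [hi.continuousOn_iff]
    exact ha.prodMk hb
  exact 𝒪.continuous_add.comp_continuousOn this

theorem continuousOn_stalk_mul {Z : Type t} [TopologicalSpace Z] {D : Set Z} {g : Z → X}
    {a b : ∀ z, 𝒪.stalk (g z)}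
    (ha : ContinuousOn (fun z => (⟨g z, a z⟩ : Σ x, 𝒪.stalk x)) D)
    (hb : ContinuousOn (fun z => (⟨g z, b z⟩ : Σ x, 𝒪.stalk x)) D) :
    ContinuousOn (fun z => (⟨g z, a z * b z⟩ : Σ x, 𝒪.stalk x)) D := by
  have hi : Topology.IsInducing (fun p : FibrePair 𝒪.stalk =>
    ((⟨p.pt, p.fst⟩ : Σ x, 𝒪.stalk x), (⟨p.pt, p.snd⟩ : Σ x, 𝒪.stalk x))) := ⟨rfl⟩
  have : ContinuousOn (fun z => (⟨a z, b z⟩ : FibrePair 𝒪.stalk)) D := by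
    rw [hi.continuousOn_iff]
    exact ha.prodMk hb
  exact 𝒪.continuous_mul.comp_continuousOn this

theorem continuousOn_stalk_act {D : Set (Arr X)} {a : ∀ γ : Arr X, 𝒪.stalk γ.left}
    (ha : ContinuousOn (fun γ : Arr X => (⟨γ.left, a γ⟩ : Σ x, 𝒪.stalk x)) D) :
    ContinuousOn (fun γ : Arr X => (⟨γ.right, 𝒪.act γ.hom (a γ)⟩ : Σ x, 𝒪.stalk x)) D := by
  have hi : Topology.IsInducing (fun p : ActPair 𝒪.stalk =>
    ((⟨p.dom, p.cod, p.arrow⟩ : Arr X), (⟨p.dom, p.val⟩ : Σ x, 𝒪.stalk x))) := ⟨rfl⟩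
  have : ContinuousOn (fun γ : Arr X => (⟨γ.hom, a γ⟩ : ActPair 𝒪.stalk)) D := by
    rw [hi.continuousOn_iff]
    exact continuousOn_id.prodMk ha
  exact 𝒪.continuous_act.comp_continuousOn this

/-- Every germ extends to a continuous section over a neighbourhood. -/
theorem exists_localSection (y : X) (a : 𝒪.stalk y) :
    ∃ (V : Set X) (s : ∀ z, 𝒪.stalk z), IsOpen V ∧ y ∈ V ∧
      ContinuousOn (fun z => (⟨z, s z⟩ : Σ x, 𝒪.stalk x)) V ∧ s y = a := by
  classical
  obtain ⟨e, he, hproj⟩ := 𝒪.isLocalHomeomorph_proj ⟨y, a⟩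
  have hy : e ⟨y, a⟩ = y := by rw [← hproj]
  have hfst : ∀ z ∈ e.target, (e.symm z).1 = z := by
    intro z hz
    conv_rhs => rw [← e.right_inv hz, ← hproj]
  let s : ∀ z, 𝒪.stalk z := fun z =>
    if h : (e.symm z).1 = z then h ▸ (e.symm z).2 else 0
  have hs : ∀ z ∈ e.target, (⟨z, s z⟩ : Σ x, 𝒪.stalk x) = e.symm z := by
    intro z hz
    have h := hfst z hz
    simp only [s, h, dite_true]
    generalize e.symm z = p at h
    obtain ⟨z', b⟩ := p
    subst h
    rfl
  have hyt : y ∈ e.target := hy ▸ e.map_source he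
  refine ⟨e.target, s, e.open_target, hyt, e.continuousOn_symm.congr hs, ?_⟩
  have h1 := hs y hyt
  have h2 : e.symm y = ⟨y, a⟩ := by
    have := e.left_inv he
    rwa [hy] at this
  rw [h2] at h1
  exact eq_of_heq (Sigma.mk.inj h1).2

/-- Two continuous sections with a common value agree nearby. -/
theorem eventuallyEq_of_eq {y : X} {s s' : ∀ z, 𝒪.stalk z}
    (hs : ContinuousAt (fun z => (⟨z, s z⟩ : Σ x, 𝒪.stalk x)) y)
    (hs' : ContinuousAt (fun z => (⟨z, s' z⟩ : Σ x, 𝒪.stalk x)) y) (h : s y = s' y) :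
    ∀ᶠ z in nhds y, s z = s' z := by
  obtain ⟨e, he, hproj⟩ := 𝒪.isLocalHomeomorph_proj ⟨y, s y⟩
  have h1 := hs.eventually_mem (e.open_source.mem_nhds he)
  rw [h] at he
  have h2 := hs'.eventually_mem (e.open_source.mem_nhds he)
  filter_upwards [h1, h2] with z hz hz'
  have := e.injOn hz hz' (by rw [← hproj])
  exact eq_of_heq (Sigma.mk.inj this).2

/-- Extend the germ 0 at `y` to a local section `s`. Since `s + s` and `s` agree at `y` they agree
nearby, which forces `s = 0` there. -/
theorem continuous_stalk_zero : Continuous (fun z : X => (⟨z, 0⟩ : Σ x, 𝒪.stalk x)) := by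
  rw [continuous_iff_continuousAt]
  intro y
  obtain ⟨V, s, hV, hy, hs, h0⟩ := exists_localSection (𝒪 := 𝒪) y 0
  have hc := hs.continuousAt (hV.mem_nhds hy)
  have hc2 := (continuousOn_stalk_add hs hs).continuousAt (hV.mem_nhds hy)
  refine hc.congr ?_
  filter_upwards [eventuallyEq_of_eq hc2 hc (by simp [h0])] with z hz
  rw [add_eq_left.mp hz]

theorem continuous_stalk_neg_one : Continuous (fun z : X => (⟨z, -1⟩ : Σ x, 𝒪.stalk x)) := by
  rw [continuous_iff_continuousAt]
  intro y
  obtain ⟨V, s, hV, hy, hs, h0⟩ := exists_localSection (𝒪 := 𝒪) y (-1)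
  have hc := hs.continuousAt (hV.mem_nhds hy)
  have hc2 := (continuousOn_stalk_add hs 𝒪.continuous_one.continuousOn).continuousAt
    (hV.mem_nhds hy)
  refine hc.congr ?_
  filter_upwards [eventuallyEq_of_eq hc2 continuous_stalk_zero.continuousAt (by simp [h0])] with z hz
  rw [eq_neg_of_add_eq_zero_left hz]

/-- Continuity of negation is not an axiom of the sheaf; it is obtained as multiplication by the
continuous section $-1$, pulled back along `g`. -/
theorem continuousOn_stalk_sub {Z : Type t} [TopologicalSpace Z] {D : Set Z} {g : Z → X}
    (hg : ContinuousOn g D) {a b : ∀ z, 𝒪.stalk (g z)}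
    (ha : ContinuousOn (fun z => (⟨g z, a z⟩ : Σ x, 𝒪.stalk x)) D)
    (hb : ContinuousOn (fun z => (⟨g z, b z⟩ : Σ x, 𝒪.stalk x)) D) :
    ContinuousOn (fun z => (⟨g z, a z - b z⟩ : Σ x, 𝒪.stalk x)) D := by
  have h1 : ContinuousOn (fun z => (⟨g z, -1⟩ : Σ x, 𝒪.stalk x)) D :=
    continuous_stalk_neg_one.comp_continuousOn hg
  refine (continuousOn_stalk_add ha (continuousOn_stalk_mul h1 hb)).congr fun z _ => ?_
  simp [sub_eq_add_neg]

end Stalkwise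

/-! ### Compact open bisections and sections supported on them -/

section Bisections

variable {X : Type u} [Groupoid.{v} X] [TopologicalSpace X] [TopologicalSpace (Arr X)]
  [IsAmpleGroupoid X]

theorem unit_mem_unitArrows (x : X) : (⟨x, x, 𝟙 x⟩ : Arr X) ∈ unitArrows X := ⟨x, rfl⟩

/-- For $\gamma$ close to a unit, both $\gamma$ and $1_{r(\gamma)}$ lie in a neighbourhood on which
$r$ is injective; they have the same range, so $\gamma$ is a unit. -/
theorem isOpen_unitArrows : IsOpen (unitArrows X) := by
  rw [isOpen_iff_mem_nhds]
  rintro _ ⟨x, rfl⟩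
  obtain ⟨e, he, hr⟩ := IsAmpleGroupoid.isLocalHomeomorph_range (X := X) ⟨x, x, 𝟙 x⟩
  have h1 : (fun x : X => (⟨x, x, 𝟙 x⟩ : Arr X)) ⁻¹' e.source ∈ nhds x :=
    IsAmpleGroupoid.continuous_unit.continuousAt.preimage_mem_nhds (e.open_source.mem_nhds he)
  have h2 := (IsAmpleGroupoid.isLocalHomeomorph_range (X := X)).continuous.continuousAt
    (x := (⟨x, x, 𝟙 x⟩ : Arr X)) |>.preimage_mem_nhds h1
  filter_upwards [h2, e.open_source.mem_nhds he] with γ hγ hγ'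
  exact ⟨γ.right, e.injOn hγ hγ' (by rw [← hr])⟩

/-- The domain map is the range map composed with the continuous injection
$\gamma\mapsto\gamma^{-1}$. -/
theorem isLocallyInjective_dom : IsLocallyInjective (fun γ : Arr X => γ.left) := by
  have h := (IsAmpleGroupoid.isLocalHomeomorph_range (X := X)).isLocallyInjective
  refine h.comp_right (g := fun γ : Arr X => (⟨γ.right, γ.left, Groupoid.inv γ.hom⟩ : Arr X))
    IsAmpleGroupoid.continuous_inv ?_
  exact Function.LeftInverse.injective
    (g := fun γ : Arr X => (⟨γ.right, γ.left, Groupoid.inv γ.hom⟩ : Arr X)) fun γ => by simp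

theorem exists_isCompactOpenBisection {γ : Arr X} {N : Set (Arr X)} (hN : IsOpen N)
    (hγ : γ ∈ N) : ∃ U, IsCompactOpenBisection U ∧ γ ∈ U ∧ U ⊆ N := by
  obtain ⟨e, he, hr⟩ := IsAmpleGroupoid.isLocalHomeomorph_range (X := X) γ
  obtain ⟨D, hD, hγD, hinj⟩ := isLocallyInjective_dom γ
  have hO : IsOpen (e.source ∩ (N ∩ D)) :=
    e.open_source.inter (hN.inter hD)
  have himg : IsOpen (e '' (e.source ∩ (N ∩ D))) :=
    e.isOpen_image_of_subset_source hO Set.inter_subset_left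
  have hmem : e γ ∈ e '' (e.source ∩ (N ∩ D)) :=
    ⟨γ, ⟨he, hγ, hγD⟩, rfl⟩
  obtain ⟨K, ⟨hKo, hKc⟩, hK, hKs⟩ :=
    IsAmpleGroupoid.isTopologicalBasis_compactOpen.exists_subset_of_mem_open hmem himg
  have hKt : K ⊆ e.target := fun z hz => by
    obtain ⟨β, hβ, rfl⟩ := hKs hz
    exact e.map_source hβ.1
  have hsub : e.symm '' K ⊆ e.source ∩ (N ∩ D) := by
    rintro _ ⟨z, hz, rfl⟩
    obtain ⟨β, hβ, rfl⟩ := hKs hz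
    rwa [e.left_inv hβ.1]
  refine ⟨e.symm '' K, ⟨?_, ?_, ?_, ?_⟩, ⟨e γ, hK, e.left_inv he⟩, fun β hβ => (hsub hβ).2.1⟩
  · exact e.symm.isOpen_image_of_subset_source hKo hKt
  · exact hKc.image_of_continuousOn (e.continuousOn_symm.mono hKt)
  · exact hinj.mono fun β hβ => (hsub hβ).2.2
  · rw [hr]
    exact e.injOn.mono fun β hβ => (hsub hβ).1

variable {𝒪 : GSheafOfRings.{u, v, w} X}

/-- Every value is attained by a section supported on an arbitrarily small compact open
bisection. -/
theorem exists_supportedOn {γ : Arr X} {N : Set (Arr X)} (hN : IsOpen N) (hγ : γ ∈ N)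
    (a : 𝒪.stalk γ.right) : ∃ (U : Set (Arr X)) (f : Sections 𝒪), IsCompactOpenBisection U ∧
      γ ∈ U ∧ U ⊆ N ∧ SupportedOn f U ∧ f γ = a := by
  classical
  obtain ⟨V, s, hV, hy, hs, rfl⟩ := exists_localSection γ.right a
  have hr := (IsAmpleGroupoid.isLocalHomeomorph_range (X := X)).continuous
  obtain ⟨U, hU, hγU, hUN⟩ := exists_isCompactOpenBisection
    (hN.inter (hV.preimage hr)) (γ := γ) ⟨hγ, hy⟩
  refine ⟨U, fun β => if β ∈ U then s β.right else 0, hU, hγU,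
    hUN.trans Set.inter_subset_left, ⟨?_, fun β hβ => if_neg hβ⟩, if_pos hγU⟩
  refine (hs.comp hr.continuousOn fun β hβ => (hUN hβ).2).congr fun β hβ => ?_
  simp [toSpace, hβ]

/-- A unit-supported section restricts to a continuous section on the unit space. -/
theorem SupportedOn.continuous_unit {a : Sections 𝒪} {W : Set (Arr X)}
    (hWo : IsCompactOpenBisection W) (hWu : W ⊆ unitArrows X) (ha : SupportedOn a W) :
    Continuous (fun x : X => (⟨x, a ⟨x, x, 𝟙 x⟩⟩ : Σ x, 𝒪.stalk x)) := by
  have hT2 : T2Space X := IsAmpleGroupoid.t2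
  have hpre : (fun x : X => (⟨x, x, 𝟙 x⟩ : Arr X)) ⁻¹' W = (fun γ : Arr X => γ.right) '' W := by
    ext x
    constructor
    · exact fun h => ⟨_, h, rfl⟩
    · rintro ⟨γ, h, rfl⟩
      obtain ⟨y, rfl⟩ := hWu h
      exact h
  have hr := (IsAmpleGroupoid.isLocalHomeomorph_range (X := X)).continuous
  rw [continuous_iff_continuousAt]
  intro x
  by_cases hx : (⟨x, x, 𝟙 x⟩ : Arr X) ∈ W
  · exact (ha.1.continuousAt (hWo.isOpen.mem_nhds hx)).comp
      (f := fun x : X => (⟨x, x, 𝟙 x⟩ : Arr X)) IsAmpleGroupoid.continuous_unit.continuousAt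
  -- Compactness in the Hausdorff unit space makes the support closed there, so the extension by
  -- zero is continuous. In the possibly non-Hausdorff arrow space `W` need not be closed.
  · have hcl : IsClosed ((fun x : X => (⟨x, x, 𝟙 x⟩ : Arr X)) ⁻¹' W) := by
      rw [hpre]
      exact (hWo.isCompact.image hr).isClosed
    refine continuous_stalk_zero.continuousAt.congr ?_
    filter_upwards [hcl.isOpen_compl.mem_nhds hx] with z hz
    rw [ha.2 _ hz]

end Bisections

/-! ### Products with sections on bisections and with diagonal elements -/

section Products

variable {X : Type u} [Groupoid.{v} X] [TopologicalSpace X] [TopologicalSpace (Arr X)]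
  {𝒪 : GSheafOfRings.{u, v, w} X}

theorem SupportedOn.mem_gammaSubgroup {f : Sections 𝒪} {U : Set (Arr X)}
    (hU : IsCompactOpenBisection U) (hf : SupportedOn f U) : f ∈ gammaSubgroup 𝒪 :=
  AddSubgroup.subset_closure ⟨U, hU, hf⟩

/-- An element of `Γ_c(𝒢, 𝒪)` from a section supported on a compact open bisection. -/
def Gamma.mk {f : Sections 𝒪} {U : Set (Arr X)} (hU : IsCompactOpenBisection U)
    (hf : SupportedOn f U) : Gamma 𝒪 := ⟨f, hf.mem_gammaSubgroup hU⟩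

open Classical in
theorem res_of_mem {f : Gamma 𝒪} {U : Set (Arr X)} (hU : IsCompactOpenBisection U)
    (hf : SupportedOn f.1 U) {x : X} (ρ : Out x) (hρ : ρ.arr ∈ U) :
    res x f = DirectSum.of (fun γ : Out x => 𝒪.stalk γ.1) ρ (f.1 ρ.arr) := by
  ext σ
  rw [res_apply]
  by_cases h : σ = ρ
  · subst h
    rw [DirectSum.of_eq_same]
  · rw [DirectSum.of_eq_of_ne _ _ _ h]
    exact hf.2 _ fun h' => h (Out.arr_injective (hU.injOn_dom h' hρ rfl))

theorem apply_eq_zero_of_mem_unit {f : Sections 𝒪} (hf : f ∈ gammaUnitSubgroup 𝒪) {γ : Arr X}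
    (hγ : γ ∉ unitArrows X) : f γ = 0 := by
  induction hf using AddSubgroup.closure_induction with
  | mem f hf =>
    obtain ⟨U, hU, -, h0⟩ := hf
    exact h0.2 _ fun h => hγ (hU h)
  | zero => rfl
  | add f g _ _ hf hg => simp [hf, hg]
  | neg f _ hf => simp [hf]

open Classical in
theorem res_of_unit {f : Gamma 𝒪} (hf : f.1 ∈ gammaUnitSubgroup 𝒪) (x : X) :
    res x f = DirectSum.of (fun γ : Out x => 𝒪.stalk γ.1) ⟨x, 𝟙 x⟩ (f.1 ⟨x, x, 𝟙 x⟩) := by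
  ext σ
  rw [res_apply]
  by_cases h : σ = ⟨x, 𝟙 x⟩
  · subst h
    rw [DirectSum.of_eq_same]
  · rw [DirectSum.of_eq_of_ne _ _ _ h]
    refine apply_eq_zero_of_mem_unit hf ?_
    rintro ⟨y, hy⟩
    obtain ⟨z, σ⟩ := σ
    simp only [Out.arr, Quiver.Total.mk.injEq] at hy
    obtain ⟨rfl, rfl, hy⟩ := hy
    exact h (by rw [eq_of_heq hy])

open Classical in
-- A diagonal element acts on the summand at $\gamma$ through its value at $r(\gamma)$ alone; this
-- is what lets the diagonal separate ranges.
theorem leftAct_of_unit {f : Gamma 𝒪} (hf : f.1 ∈ gammaUnitSubgroup 𝒪) {x : X} (γ : Out x)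
    (a : 𝒪.stalk γ.1) :
    leftAct x f (DirectSum.of (fun γ : Out x => 𝒪.stalk γ.1) γ a) =
      DirectSum.of (fun γ : Out x => 𝒪.stalk γ.1) γ (f.1 ⟨γ.1, γ.1, 𝟙 γ.1⟩ * a) := by
  obtain ⟨y, γ⟩ := γ
  rw [leftAct_of, res_of_unit hf, shift_of, 𝒪.act_id]
  exact of_congr (Category.comp_id _) _

open Classical in
theorem leftAct_of_mem {f : Gamma 𝒪} {U : Set (Arr X)} (hU : IsCompactOpenBisection U)
    (hf : SupportedOn f.1 U) {x y : X} (γ : x ⟶ y) (ρ : Out y) (hρ : ρ.arr ∈ U) (a : 𝒪.stalk y) :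
    leftAct x f (DirectSum.of (fun γ : Out x => 𝒪.stalk γ.1) ⟨y, γ⟩ a) =
      DirectSum.of (fun γ : Out x => 𝒪.stalk γ.1) ⟨ρ.1, γ ≫ ρ.2⟩
        (f.1 ρ.arr * 𝒪.act ρ.2 a) := by
  rw [leftAct_of, res_of_mem hU hf ρ hρ, shift_of]

/-- Only the factorization $\gamma=\gamma\cdot1_{d(\gamma)}$ can contribute. -/
theorem conv_unit_right {f a : Sections 𝒪} (ha : ∀ γ, γ ∉ unitArrows X → a γ = 0) (γ : Arr X) :
    conv f a γ = f γ * 𝒪.act γ.hom (a ⟨γ.left, γ.left, 𝟙 γ.left⟩) := by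
  obtain ⟨x, y, γ⟩ := γ
  have h : conv f a ⟨x, y, γ⟩ = _ :=
    finsum_eq_single (M := 𝒪.stalk y) _ (⟨x, 𝟙 x⟩ : Out x) (fun ρ hρ => ?_)
  · rw [h]
    -- The arrow is generalized to `β` because the type of the value of `f` depends on it.
    have h2 : ∀ β : x ⟶ y, β = γ → f ⟨x, y, β⟩ * 𝒪.act β (a ⟨x, x, 𝟙 x⟩) =
      f ⟨x, y, γ⟩ * 𝒪.act γ (a ⟨x, x, 𝟙 x⟩) := by rintro _ rfl; rfl
    exact h2 _ (by simp)
  · rw [ha, map_zero, mul_zero]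
    rintro ⟨z, hz⟩
    obtain ⟨w, ρ⟩ := ρ
    simp only [Out.arr, Quiver.Total.mk.injEq] at hz
    obtain ⟨rfl, rfl, hz⟩ := hz
    exact hρ (by rw [eq_of_heq hz])

/-- Only the factorization $\gamma=1_{r(\gamma)}\cdot\gamma$ can contribute. -/
theorem conv_unit_left {f a : Sections 𝒪} (ha : ∀ γ, γ ∉ unitArrows X → a γ = 0) (γ : Arr X) :
    conv a f γ = a ⟨γ.right, γ.right, 𝟙 γ.right⟩ * f γ := by
  obtain ⟨x, y, γ⟩ := γ
  have h : conv a f ⟨x, y, γ⟩ = _ :=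
    finsum_eq_single (M := 𝒪.stalk y) _ (⟨y, γ⟩ : Out x) (fun ρ hρ => ?_)
  · rw [h]
    have h2 : ∀ β : y ⟶ y, β = 𝟙 y → a ⟨y, y, β⟩ * 𝒪.act β (f ⟨x, y, γ⟩) =
      a ⟨y, y, 𝟙 y⟩ * f ⟨x, y, γ⟩ := by rintro _ rfl; rw [𝒪.act_id]
    exact h2 _ (by simp)
  · rw [ha, zero_mul]
    rintro ⟨z, hz⟩
    obtain ⟨w, ρ⟩ := ρ
    simp only [Quiver.Total.mk.injEq] at hz
    obtain ⟨rfl, rfl, hz⟩ := hz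
    apply hρ
    have hz := eq_of_heq hz
    have : ρ = γ := by
      rw [← Category.comp_id ρ, hz]
      simp
    rw [this]

variable [IsAmpleGroupoid X]

/-- The commutator with a unit-supported section does not enlarge the support. -/
theorem supportedOn_commutator {a f : Sections 𝒪} {U W : Set (Arr X)}
    (hW : IsCompactOpenBisection W) (hWu : W ⊆ unitArrows X) (ha : SupportedOn a W)
    (hf : SupportedOn f U) : SupportedOn (conv a f - conv f a) U := by
  have ha0 : ∀ γ, γ ∉ unitArrows X → a γ = 0 := fun γ hγ => ha.2 _ fun h => hγ (hWu h)
  have hc := ha.continuous_unit hW hWu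
  have hr := (IsAmpleGroupoid.isLocalHomeomorph_range (X := X)).continuous
  have h1 : ContinuousOn (fun γ : Arr X =>
      (⟨γ.right, a ⟨γ.right, γ.right, 𝟙 γ.right⟩⟩ : Σ x, 𝒪.stalk x)) U :=
    (hc.comp hr).continuousOn
  have h2 : ContinuousOn (fun γ : Arr X =>
      (⟨γ.left, a ⟨γ.left, γ.left, 𝟙 γ.left⟩⟩ : Σ x, 𝒪.stalk x)) U :=
    (hc.comp IsAmpleGroupoid.continuous_dom).continuousOn
  refine ⟨?_, fun γ hγ => ?_⟩
  -- The commutator is $\gamma\mapsto a(r(\gamma))f(\gamma)-f(\gamma)\alpha_\gamma(a(d(\gamma)))$.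
  · refine (continuousOn_stalk_sub hr.continuousOn (continuousOn_stalk_mul h1 hf.1)
      (continuousOn_stalk_mul hf.1 (continuousOn_stalk_act h2))).congr fun γ _ => ?_
    simp only [toSpace, Pi.sub_apply, conv_unit_left ha0, conv_unit_right ha0]
  · simp [conv_unit_left ha0, conv_unit_right ha0, hf.2 γ hγ]

end Products

/-! ### Induced modules of simple modules are simple -/

section Simple

variable {X : Type u} [Groupoid.{v} X] [TopologicalSpace X] [TopologicalSpace (Arr X)]
  {𝒪 : GSheafOfRings.{u, v, w} X} {x : X} {M : Type t} [AddCommGroup M]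
  [Module (IsotropyRing 𝒪 x) M]

/-- The class of `l ⊗ m` in `Ind_x(M)`. -/
noncomputable def indTmul : Ell 𝒪 x →+ M →+ Ind 𝒪 x M :=
  AddMonoidHom.mk' (fun l => AddMonoidHom.mk'
    (fun m => QuotientAddGroup.mk' (balanced 𝒪 x M) (l ⊗ₜ[ℤ] m)) fun m n => by
      rw [TensorProduct.tmul_add, map_add]) fun l l' => by
    ext m
    simp only [AddMonoidHom.mk'_apply, AddMonoidHom.add_apply, TensorProduct.add_tmul, map_add]

theorem indTmul_rightAct (l : Ell 𝒪 x) (b : IsotropyRing 𝒪 x) (m : M) :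
    indTmul (rightAct x b l) m = indTmul l (b • m) := by
  refine (QuotientAddGroup.eq_iff_sub_mem).mpr ?_
  exact AddSubgroup.subset_closure ⟨l, b, m, rfl⟩

theorem Ind.induction {p : Ind 𝒪 x M → Prop} (n : Ind 𝒪 x M)
    (tmul : ∀ l m, p (indTmul l m)) (add : ∀ a b, p a → p b → p (a + b)) : p n := by
  induction n using QuotientAddGroup.induction_on with
  | H z =>
    induction z using TensorProduct.induction_on with
    | zero =>
      have := tmul 0 0
      rwa [map_zero] at this
    | tmul l m => exact tmul l m
    | add z w h1 h2 => exact add _ _ h1 h2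

theorem single_mul_single_isotropy (γ δ : End x) (a c : 𝒪.stalk x) :
    (SkewMonoidAlgebra.single γ a : IsotropyRing 𝒪 x) * SkewMonoidAlgebra.single δ c =
      SkewMonoidAlgebra.single (show End x from (show x ⟶ x from δ) ≫ (show x ⟶ x from γ))
        (a * 𝒪.act (show x ⟶ x from γ) c) :=
  SkewMonoidAlgebra.single_mul_single

variable (𝒪 x) in
open Classical in
/-- The projection of `𝓛_x` onto the skew group ring of the isotropy group at `x`. -/
noncomputable def isotropyPart : Ell 𝒪 x →+ IsotropyRing 𝒪 x :=
  DirectSum.toAddMonoid fun γ : Out x =>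
    if h : γ.1 = x then
      (SkewMonoidAlgebra.singleAddHom (show End x from γ.2 ≫ eqToHom h)).comp
        (𝒪.act (eqToHom h)).toAddMonoidHom
    else 0

open Classical in
theorem isotropyPart_of (γ : x ⟶ x) (a : 𝒪.stalk x) :
    isotropyPart 𝒪 x (DirectSum.of (fun γ : Out x => 𝒪.stalk γ.1) ⟨x, γ⟩ a) =
      SkewMonoidAlgebra.single (show End x from γ) a := by
  simp [isotropyPart, 𝒪.act_id]

open Classical in
theorem isotropyPart_of_ne {y : X} (γ : x ⟶ y) (a : 𝒪.stalk y) (h : y ≠ x) :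
    isotropyPart 𝒪 x (DirectSum.of (fun γ : Out x => 𝒪.stalk γ.1) ⟨y, γ⟩ a) = 0 := by
  simp [isotropyPart, h]

/-- Right multiplication by isotropy does not change the range of an arrow. This linearity makes
`indEval` well defined on the balanced tensor product. -/
theorem isotropyPart_rightAct (b : IsotropyRing 𝒪 x) (l : Ell 𝒪 x) :
    isotropyPart 𝒪 x (rightAct x b l) = isotropyPart 𝒪 x l * b := by
  classical
  induction b using SkewMonoidAlgebra.induction_on with
  | zero => simp
  | single δ b =>
    rw [rightAct_single]
    induction l using DirectSum.induction_on with
    | zero => simp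
    | of γ a =>
      obtain ⟨y, γ⟩ := γ
      rw [rightActSingle_of]
      by_cases h : y = x
      · subst h
        rw [isotropyPart_of, isotropyPart_of, single_mul_single_isotropy]
      · rw [isotropyPart_of_ne _ _ h, isotropyPart_of_ne _ _ h, zero_mul]
    | add l m h1 h2 => simp only [map_add, h1, h2, add_mul]
  | add b c h1 h2 => simp only [map_add, AddMonoidHom.add_apply, h1, h2, mul_add]

variable (𝒪 x M) in
/-- The map `Ind_x(M) → M` that sends `l ⊗ m` to the isotropy part of `l` applied to `m`. -/
noncomputable def indEval : Ind 𝒪 x M →+ M :=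
  QuotientAddGroup.lift (balanced 𝒪 x M)
    (TensorProduct.liftAddHom
      ((smulAddHom (IsotropyRing 𝒪 x) M).comp (isotropyPart 𝒪 x))
      (by intros; simp only [map_zsmul, AddMonoidHom.smul_apply]))
    (by
      rw [balanced, AddSubgroup.closure_le]
      rintro _ ⟨l, b, m, rfl⟩
      simp [isotropyPart_rightAct, mul_smul])

theorem indEval_indTmul (l : Ell 𝒪 x) (m : M) :
    indEval 𝒪 x M (indTmul l m) = isotropyPart 𝒪 x l • m := rfl

open Classical in
-- Two arrows from $x$ to $y$ differ by isotropy: $a1_\gamma=1_{\gamma_0}\cdot b$ with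
-- $b=\alpha_{\gamma_0^{-1}}(a)\,\gamma_0^{-1}\gamma\in B_x$, and $b$ passes through the tensor
-- sign.
theorem indTmul_of_eq {y : X} (γ₀ γ : x ⟶ y) (a : 𝒪.stalk y) (m : M) :
    ∃ m' : M, indTmul (DirectSum.of (fun γ : Out x => 𝒪.stalk γ.1) ⟨y, γ⟩ a) m =
      indTmul (DirectSum.of (fun γ : Out x => 𝒪.stalk γ.1) ⟨y, γ₀⟩ 1) m' := by
  refine ⟨(SkewMonoidAlgebra.single (show End x from γ ≫ Groupoid.inv γ₀)
    (𝒪.act (Groupoid.inv γ₀) a) : IsotropyRing 𝒪 x) • m, ?_⟩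
  rw [← indTmul_rightAct, rightAct_single, rightActSingle_of, one_mul, ← 𝒪.act_comp,
    of_congr (show γ = (γ ≫ Groupoid.inv γ₀) ≫ γ₀ by simp)]
  have h : ∀ β : y ⟶ y, β = 𝟙 y → 𝒪.act β a = a := by rintro _ rfl; exact 𝒪.act_id _ _
  rw [h _ (by simp)]

variable (𝒪 M) in
open Classical in
/-- The elements `1_γ ⊗ m` of `Ind_x(M)` with `γ` of range `y`, together with zero. -/
def indComponent (y : X) : Set (Ind 𝒪 x M) :=
  {c | c = 0 ∨ ∃ (γ : x ⟶ y) (m : M),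
    c = indTmul (𝒪 := 𝒪) (DirectSum.of (fun γ : Out x => 𝒪.stalk γ.1) ⟨y, γ⟩ 1) m}

theorem indComponent_add {y : X} {c d : Ind 𝒪 x M} (hc : c ∈ indComponent 𝒪 M y)
    (hd : d ∈ indComponent 𝒪 M y) : c + d ∈ indComponent 𝒪 M y := by
  obtain rfl | ⟨γ, m, rfl⟩ := hc
  · rwa [zero_add]
  obtain rfl | ⟨δ, n, rfl⟩ := hd
  · rw [add_zero]
    exact Or.inr ⟨γ, m, rfl⟩
  obtain ⟨m', h⟩ := indTmul_of_eq (𝒪 := 𝒪) γ δ 1 n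
  exact Or.inr ⟨γ, m + m', by rw [h, map_add]⟩

/-- Every element of `Ind_x(M)` is a finite sum of tensors `1_γ ⊗ m`, with at most one `γ` for
every range. -/
theorem exists_indComponent_sum (n : Ind 𝒪 x M) : ∃ c : X →₀ Ind 𝒪 x M,
    n = c.sum (fun _ d => d) ∧ ∀ y, c y ∈ indComponent 𝒪 M y := by
  classical
  have hadd : ∀ a b : Ind 𝒪 x M,
      (∃ c : X →₀ Ind 𝒪 x M, a = c.sum (fun _ d => d) ∧ ∀ y, c y ∈ indComponent 𝒪 M y) →
      (∃ c : X →₀ Ind 𝒪 x M, b = c.sum (fun _ d => d) ∧ ∀ y, c y ∈ indComponent 𝒪 M y) →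
      ∃ c : X →₀ Ind 𝒪 x M, a + b = c.sum (fun _ d => d) ∧ ∀ y, c y ∈ indComponent 𝒪 M y := by
    rintro _ _ ⟨c, rfl, hc⟩ ⟨d, rfl, hd⟩
    refine ⟨c + d, ?_, fun y => indComponent_add (hc y) (hd y)⟩
    rw [Finsupp.sum_add_index' (fun _ => rfl) (fun _ _ _ => rfl)]
  induction n using Ind.induction with
  | add a b h1 h2 => exact hadd a b h1 h2
  | tmul l m =>
    induction l using DirectSum.induction_on with
    | zero => exact ⟨0, by simp, fun y => Or.inl rfl⟩
    | add l l' h1 h2 =>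
      rw [map_add, AddMonoidHom.add_apply]
      exact hadd _ _ h1 h2
    | of γ a =>
      obtain ⟨y, γ⟩ := γ
      obtain ⟨m', h⟩ := indTmul_of_eq γ γ a m
      refine ⟨Finsupp.single y (indTmul (DirectSum.of _ ⟨y, γ⟩ a) m), by simp, fun z => ?_⟩
      by_cases hz : z = y
      · subst hz
        rw [Finsupp.single_eq_same]
        exact Or.inr ⟨γ, m', h⟩
      · rw [Finsupp.single_eq_of_ne hz]
        exact Or.inl rfl

variable [IsAmpleGroupoid X]

theorem indModule_indTmul (f : Gamma 𝒪) (l : Ell 𝒪 x) (m : M) :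
    indModule 𝒪 x M f (indTmul l m) = indTmul (leftAct x f l) m := rfl

theorem indModule_indComponent_one {f : Gamma 𝒪} (hf : f.1 ∈ gammaUnitSubgroup 𝒪) {y : X}
    (hy : f.1 ⟨y, y, 𝟙 y⟩ = 1) {c : Ind 𝒪 x M} (hc : c ∈ indComponent 𝒪 M y) :
    indModule 𝒪 x M f c = c := by
  obtain rfl | ⟨γ, m, rfl⟩ := hc
  · exact map_zero _
  · rw [indModule_indTmul, leftAct_of_unit hf, hy, mul_one]

theorem indModule_indComponent_zero {f : Gamma 𝒪} (hf : f.1 ∈ gammaUnitSubgroup 𝒪) {y : X}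
    (hy : f.1 ⟨y, y, 𝟙 y⟩ = 0) {c : Ind 𝒪 x M} (hc : c ∈ indComponent 𝒪 M y) :
    indModule 𝒪 x M f c = 0 := by
  obtain rfl | ⟨γ, m, rfl⟩ := hc
  · exact map_zero _
  · rw [indModule_indTmul, leftAct_of_unit hf, hy, zero_mul, map_zero, map_zero]
    rfl

variable (𝒪) in
/-- An element of the diagonal subring with value one at a given unit that vanishes at finitely
many other units. -/
theorem exists_separating (y : X) (S : Finset X) : ∃ f : Gamma 𝒪, f.1 ∈ gammaUnitSubgroup 𝒪 ∧
    f.1 ⟨y, y, 𝟙 y⟩ = 1 ∧ ∀ z ∈ S, z ≠ y → f.1 ⟨z, z, 𝟙 z⟩ = 0 := by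
  classical
  have hT2 : T2Space X := IsAmpleGroupoid.t2
  have hr := (IsAmpleGroupoid.isLocalHomeomorph_range (X := X)).continuous
  -- Finite sets of units are closed, so a small enough support around $1_y$ avoids the other points
  -- of `S`.
  have hN : IsOpen (unitArrows X ∩ (fun γ : Arr X => γ.right) ⁻¹' (↑(S.erase y) : Set X)ᶜ) :=
    isOpen_unitArrows.inter ((S.erase y).finite_toSet.isClosed.isOpen_compl.preimage hr)
  obtain ⟨U, f, hU, -, hUN, hf, h1⟩ := exists_supportedOn (𝒪 := 𝒪) (γ := ⟨y, y, 𝟙 y⟩) hN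
    ⟨unit_mem_unitArrows y, by simp⟩ 1
  refine ⟨Gamma.mk hU hf, AddSubgroup.subset_closure
    ⟨U, hUN.trans Set.inter_subset_left, hU, hf⟩, h1, fun z hz hzy => hf.2 _ fun h => ?_⟩
  exact (hUN h).2 (Finset.mem_coe.mpr (Finset.mem_erase.mpr ⟨hzy, hz⟩))

/-- A submodule of `Ind_x(M)` contains the components of its elements. -/
theorem component_mem {N : AddSubgroup (Ind 𝒪 x M)} (hN : IsSubmodule (indModule 𝒪 x M) N)
    {c : X →₀ Ind 𝒪 x M} (hc : ∀ y, c y ∈ indComponent 𝒪 M y)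
    (hmem : c.sum (fun _ d => d) ∈ N) (y : X) : c y ∈ N := by
  obtain ⟨f, hf, h1, h0⟩ := exists_separating 𝒪 y c.support
  have h := hN f _ hmem
  -- On this sum `f` acts as the projection onto the component of range `y`.
  have h2 : indModule 𝒪 x M f (c.sum fun _ d => d) = c y := by
    rw [Finsupp.sum, map_sum, Finset.sum_eq_single y]
    · exact indModule_indComponent_one hf h1 (hc y)
    · exact fun z hz hzy => indModule_indComponent_zero hf (h0 z hz hzy) (hc z)
    · intro hy
      rw [Finsupp.notMem_support_iff.mp hy, map_zero]
  rwa [h2] at h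

open Classical in
/-- A submodule that contains `1_γ ⊗ m` contains `𝓛_x ⊗ m`. -/
theorem indTmul_mem {N : AddSubgroup (Ind 𝒪 x M)} (hN : IsSubmodule (indModule 𝒪 x M) N)
    {y : X} {γ : x ⟶ y} {m : M}
    (h : indTmul (DirectSum.of (fun γ : Out x => 𝒪.stalk γ.1) ⟨y, γ⟩ 1) m ∈ N) (l : Ell 𝒪 x) :
    indTmul l m ∈ N := by
  induction l using DirectSum.induction_on with
  | zero =>
    rw [map_zero]
    exact zero_mem N
  | add l l' h1 h2 =>
    rw [map_add]
    exact add_mem h1 h2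
  | of δ a =>
    obtain ⟨z, δ⟩ := δ
    -- A bisectional section with value $a$ at $\delta\gamma^{-1}$ sends $1_\gamma$ to $a1_\delta$.
    obtain ⟨U, f, hU, hmem, -, hf, rfl⟩ := exists_supportedOn (𝒪 := 𝒪)
      (γ := ⟨y, z, Groupoid.inv γ ≫ δ⟩) isOpen_univ trivial a
    have h2 := hN (Gamma.mk hU hf) _ h
    rw [indModule_indTmul, leftAct_of_mem hU hf γ ⟨z, Groupoid.inv γ ≫ δ⟩ hmem, map_one,
      mul_one, of_congr (show γ ≫ Groupoid.inv γ ≫ δ = δ by simp)] at h2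
    exact h2

variable (𝒪 x M) in
/-- Induction preserves simple modules. -/
theorem isSimple_indModule [IsSimpleModule (IsotropyRing 𝒪 x) M] :
    IsSimple (indModule 𝒪 x M) := by
  classical
  refine ⟨fun r m _ => trivial, ?_, fun N hN _ => ?_⟩
  · have := IsSimpleModule.nontrivial (IsotropyRing 𝒪 x) M
    obtain ⟨m, hm⟩ := exists_ne (0 : M)
    obtain ⟨f, hf, h1, -⟩ := exists_separating 𝒪 x ∅
    refine ⟨f, indTmul (DirectSum.of (fun γ : Out x => 𝒪.stalk γ.1) ⟨x, 𝟙 x⟩ 1) m, trivial, ?_⟩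
    rw [indModule_indComponent_one hf h1 (Or.inr ⟨_, _, rfl⟩)]
    intro h
    have h2 := congrArg (indEval 𝒪 x M) h
    rw [indEval_indTmul, isotropyPart_of, map_zero] at h2
    exact hm ((one_smul (IsotropyRing 𝒪 x) m).symm.trans h2)
  · by_cases hbot : N = ⊥
    · exact Or.inl hbot
    refine Or.inr ((AddSubgroup.eq_top_iff' N).mpr ?_)
    obtain ⟨⟨n, hn⟩, hne⟩ := AddSubgroup.ne_bot_iff_exists_ne_zero.mp hbot
    have hn0 : n ≠ 0 := fun h => hne (Subtype.ext h)
    obtain ⟨c, hc, hcomp⟩ := exists_indComponent_sum n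
    obtain ⟨y, hy⟩ : ∃ y, c y ≠ 0 := by
      by_contra! h
      apply hn0
      rw [hc, Finsupp.sum]
      exact Finset.sum_eq_zero fun y _ => h y
    have hyN := component_mem hN hcomp (hc ▸ hn) y
    obtain h0 | ⟨γ, m, hm⟩ := hcomp y
    · exact absurd h0 hy
    have hm0 : m ≠ 0 := by
      rintro rfl
      exact hy (hm.trans (map_zero _))
    -- Stability under $B_x$ holds since $l\otimes bm=lb\otimes m$ and the condition ranges over all
    -- $l$.
    let P : Submodule (IsotropyRing 𝒪 x) M :=
      { carrier := {m | ∀ l : Ell 𝒪 x, indTmul l m ∈ N}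
        add_mem' := fun h1 h2 l => by
          rw [map_add]
          exact add_mem (h1 l) (h2 l)
        zero_mem' := fun l => by
          rw [map_zero]
          exact zero_mem N
        smul_mem' := fun b m h l => by
          rw [← indTmul_rightAct]
          exact h _ }
    have hP : P = ⊤ := (eq_bot_or_eq_top P).resolve_left fun h => by
      have : m ∈ P := indTmul_mem hN (hm ▸ hyN)
      rw [h] at this
      exact hm0 this
    intro k
    induction k using Ind.induction with
    | tmul l m =>
      have : m ∈ P := hP ▸ trivial
      exact this l
    | add a b h1 h2 => exact add_mem h1 h2

end Simple

/-! ### Direct sums of simple modules -/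

section Semisimple

variable {R : Type u} [NonUnitalRing R] {ι : Type v} {M : ι → Type t} [∀ i, AddCommGroup (M i)]

open Classical in
theorem directSumModule_of (ρ : ∀ i, R →ₙ+* AddMonoid.End (M i)) (r : R) (i : ι) (m : M i) :
    directSumModule ρ r (DirectSum.of M i m) = DirectSum.of M i (ρ i r m) :=
  DirectSum.map_of _ _ _

open Classical in
/-- A direct sum of simple modules is semisimple. -/
theorem isSemisimple_directSumModule (ρ : ∀ i, R →ₙ+* AddMonoid.End (M i))
    (h : ∀ i, IsSimple (ρ i)) : IsSemisimple (directSumModule ρ) := by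
  have hs : ∀ i, IsSimpleSubmodule (directSumModule ρ) (DirectSum.of M i).range := by
    intro i
    refine ⟨?_, ?_, fun K hK hle => ?_⟩
    · rintro r _ ⟨m, rfl⟩
      exact ⟨ρ i r m, (directSumModule_of ρ r i m).symm⟩
    · obtain ⟨r, m, -, hm⟩ := (h i).2.1
      refine ⟨r, DirectSum.of M i m, ⟨m, rfl⟩, fun h0 => hm ?_⟩
      rw [directSumModule_of] at h0
      exact DirectSum.of_injective i (h0.trans (map_zero _).symm)
    · have hsub : IsSubmodule (ρ i) (K.comap (DirectSum.of M i)) := fun r m hm => by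
        have := hK r _ hm
        rwa [directSumModule_of] at this
      have hK2 : K = (K.comap (DirectSum.of M i)).map (DirectSum.of M i) := by
        rw [AddSubgroup.map_comap_eq, inf_eq_right.mpr hle]
      rcases (h i).2.2 _ hsub le_top with h0 | h1
      · left
        rw [hK2, h0, AddSubgroup.map_bot]
      · right
        rw [hK2, h1, AddMonoidHom.range_eq_map]
  refine (AddSubgroup.eq_top_iff' _).mpr fun k => ?_
  induction k using DirectSum.induction_on with
  | zero => exact zero_mem _
  | of i m => exact (le_sSup (hs i) : (DirectSum.of M i).range ≤ _) ⟨m, rfl⟩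
  | add a b h1 h2 => exact add_mem h1 h2

end Semisimple

/-! ### Two-sided ideals meet a maximal commutative diagonal -/

section Ideals

/-- Adjoining `r` to `S` gives pairwise commuting generators, so the subring they generate is
commutative and maximality applies. -/
theorem IsMaximalCommutative.mem_of_commute {R : Type u} [NonUnitalRing R]
    {S : NonUnitalSubring R} (hS : IsMaximalCommutative S) {r : R}
    (h : ∀ a ∈ S, a * r = r * a) : r ∈ S := by
  have hcomm : ∀ a ∈ (S : Set R) ∪ {r}, ∀ b ∈ (S : Set R) ∪ {r}, a * b = b * a := by
    rintro a (ha | rfl) b (hb | rfl)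
    · exact hS.1 a ha b hb
    · exact h a ha
    · exact (h b hb).symm
    · rfl
  have := NonUnitalSubring.isMulCommutative_closure hcomm
  refine hS.2 (y := NonUnitalSubring.closure ((S : Set R) ∪ {r})) (fun a ha b hb => ?_)
    (fun a ha => NonUnitalSubring.subset_closure (Or.inl ha))
    (NonUnitalSubring.subset_closure (Or.inr rfl))
  exact setLike_mul_comm ha hb

variable {X : Type u} [Groupoid.{v} X] [TopologicalSpace X] [TopologicalSpace (Arr X)]
  [IsAmpleGroupoid X] {𝒪 : GSheafOfRings.{u, v, w} X}

/-- Elements of `Γ_c(𝒢, 𝒪)` that are supported on a compact open bisection. -/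
def IsBisectional (f : Gamma 𝒪) : Prop :=
  ∃ U : Set (Arr X), IsCompactOpenBisection U ∧ SupportedOn f.1 U

theorem IsBisectional.mul {f g : Gamma 𝒪} (hf : IsBisectional f) (hg : IsBisectional g) :
    IsBisectional (f * g) := by
  obtain ⟨U, hU, hfU⟩ := hf
  obtain ⟨V, hV, hgV⟩ := hg
  exact ⟨_, isCompactOpenBisection_setMul hU hV, supportedOn_conv hV hfU hgV⟩

theorem IsBisectional.neg {f : Gamma 𝒪} (hf : IsBisectional f) : IsBisectional (-f) := by
  obtain ⟨U, hU, hfU⟩ := hf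
  have hr := (IsAmpleGroupoid.isLocalHomeomorph_range (X := X)).continuous
  refine ⟨U, hU, ?_, fun γ hγ => neg_eq_zero.mpr (hfU.2 γ hγ)⟩
  refine (continuousOn_stalk_sub hr.continuousOn
    (continuous_stalk_zero.comp hr).continuousOn hfU.1).congr fun γ _ => ?_
  exact congrArg (Sigma.mk γ.right) (zero_sub (f.1 γ)).symm

/-- The length of such a list is the induction parameter in `eq_zero_of_mem_ideal`; signs are
absorbed into the terms. -/
theorem exists_list_isBisectional (f : Gamma 𝒪) :
    ∃ l : List (Gamma 𝒪), (∀ g ∈ l, IsBisectional g) ∧ l.sum = f := by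
  obtain ⟨f, hf⟩ := f
  induction hf using AddSubgroup.closure_induction with
  | mem f hf =>
    obtain ⟨U, hU, hfU⟩ := hf
    refine ⟨[Gamma.mk hU hfU], fun g hg => ?_, List.sum_singleton⟩
    rw [List.mem_singleton.mp hg]
    exact ⟨U, hU, hfU⟩
  | zero => exact ⟨[], by simp, rfl⟩
  | add f g _ _ h1 h2 =>
    obtain ⟨l, hl, hs⟩ := h1
    obtain ⟨l', hl', hs'⟩ := h2
    refine ⟨l ++ l', fun g hg => ?_, ?_⟩
    · exact (List.mem_append.mp hg).elim (hl g) (hl' g)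
    · rw [List.sum_append, hs, hs']
      rfl
  | neg f _ h =>
    obtain ⟨l, hl, hs⟩ := h
    refine ⟨l.map (fun g => -g), fun g hg => ?_, ?_⟩
    · obtain ⟨k, hk, rfl⟩ := List.mem_map.mp hg
      exact (hl k hk).neg
    · have := (map_list_sum (negAddMonoidHom : Gamma 𝒪 →+ Gamma 𝒪) l).symm
      rw [hs] at this
      exact this

theorem mul_apply_unit {f e : Gamma 𝒪} (he : e.1 ∈ gammaUnitSubgroup 𝒪) {y : X}
    (h1 : e.1 ⟨y, y, 𝟙 y⟩ = 1) : (f * e).1 ⟨y, y, 𝟙 y⟩ = f.1 ⟨y, y, 𝟙 y⟩ := by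
  refine (conv_unit_right (fun γ hγ => apply_eq_zero_of_mem_unit he hγ) _).trans ?_
  simp [h1]

/-- Any value of an element of `Γ_c(𝒢, 𝒪)` can be moved to a unit by a right multiplication. -/
theorem exists_mul_apply_unit (f : Gamma 𝒪) (γ : Arr X) : ∃ g : Gamma 𝒪, IsBisectional g ∧
    (f * g).1 ⟨γ.right, γ.right, 𝟙 γ.right⟩ = f.1 γ := by
  obtain ⟨x, y, γ⟩ := γ
  -- With $g(\gamma^{-1})=1$, the value of $f*g$ at $1_{r(\gamma)}$ is
  -- $f(\gamma)\alpha_\gamma(1)=f(\gamma)$.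
  obtain ⟨V, g, hV, hmem, -, hg, h1⟩ := exists_supportedOn (𝒪 := 𝒪)
    (γ := ⟨y, x, Groupoid.inv γ⟩) isOpen_univ trivial 1
  refine ⟨Gamma.mk hV hg, ⟨V, hV, hg⟩, ?_⟩
  refine (conv_eq_of_mem hV hg ⟨y, y, 𝟙 y⟩ ⟨x, Groupoid.inv γ⟩ hmem).trans ?_
  have h : ∀ β : x ⟶ y, β = γ → f.1 ⟨x, y, β⟩ * 𝒪.act β 1 = f.1 ⟨x, y, γ⟩ := by
    rintro _ rfl
    simp
  dsimp only [Out.arr] at h1 ⊢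
  rw [h1]
  exact h _ (by simp)

/-- Near a unit in its support, a bisectional element lies in the diagonal subring. -/
theorem exists_mul_mem_unit {k : Gamma 𝒪} (hk : IsBisectional k) {y : X}
    (hy : k.1 ⟨y, y, 𝟙 y⟩ ≠ 0) : ∃ e : Gamma 𝒪, IsBisectional e ∧ e.1 ∈ gammaUnitSubgroup 𝒪 ∧
      e.1 ⟨y, y, 𝟙 y⟩ = 1 ∧ (k * e).1 ∈ gammaUnitSubgroup 𝒪 := by
  obtain ⟨V, hV, hkV⟩ := hk
  have hyV : (⟨y, y, 𝟙 y⟩ : Arr X) ∈ V := by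
    by_contra h
    exact hy (hkV.2 _ h)
  obtain ⟨W, e, hW, -, hWV, he, h1⟩ := exists_supportedOn (𝒪 := 𝒪) (γ := ⟨y, y, 𝟙 y⟩)
    (isOpen_unitArrows.inter hV.isOpen) ⟨unit_mem_unitArrows y, hyV⟩ 1
  refine ⟨Gamma.mk hW he, ⟨W, hW, he⟩, AddSubgroup.subset_closure
    ⟨W, hWV.trans Set.inter_subset_left, hW, he⟩, h1, AddSubgroup.subset_closure
    ⟨setMul V W, ?_, isCompactOpenBisection_setMul hV hW, supportedOn_conv hW hkV he⟩⟩
  rintro ⟨x, z, γ⟩ ⟨⟨x', ρ⟩, hρ, hq⟩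
  obtain ⟨⟨w, hw⟩, hρV⟩ := hWV hρ
  simp only [Out.arr, Quiver.Total.mk.injEq] at hw
  obtain ⟨rfl, rfl, hw⟩ := hw
  obtain rfl := eq_of_heq hw
  -- The left factor and the unit $1_w$ both lie in the bisection `V` and have domain $w$, so the
  -- left factor is a unit as well.
  have h2 := hV.injOn_dom hq hρV rfl
  simp only [Quiver.Total.mk.injEq] at h2
  obtain ⟨-, rfl, h2⟩ := h2
  have h2 := eq_of_heq h2
  simp only [Groupoid.inv_eq_inv, IsIso.inv_id, Category.id_comp] at h2
  rw [h2]
  exact unit_mem_unitArrows _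

theorem IsBisectional.commutator {a f : Gamma 𝒪} (hf : IsBisectional f) {W : Set (Arr X)}
    (hWu : W ⊆ unitArrows X) (hW : IsCompactOpenBisection W) (ha : SupportedOn a.1 W) :
    IsBisectional (a * f - f * a) := by
  obtain ⟨U, hU, hfU⟩ := hf
  exact ⟨U, hU, supportedOn_commutator hW hWu ha hfU⟩

/-- To commute with the diagonal subring it suffices to commute with its generators. -/
theorem commute_of_commute_generators {p : Gamma 𝒪}
    (h : ∀ (a : Gamma 𝒪) (W : Set (Arr X)), W ⊆ unitArrows X → IsCompactOpenBisection W →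
      SupportedOn a.1 W → a * p = p * a) {a : Gamma 𝒪} (ha : a ∈ gammaUnit 𝒪) :
    a * p = p * a := by
  obtain ⟨a, haΓ⟩ := a
  replace ha : a ∈ gammaUnitSubgroup 𝒪 := ha
  suffices hc : conv a p.1 = conv p.1 a from Subtype.ext hc
  clear haΓ
  induction ha using AddSubgroup.closure_induction with
  | mem a ha =>
    obtain ⟨W, hWu, hW, haW⟩ := ha
    exact congrArg Subtype.val (h (Gamma.mk hW haW) W hWu hW haW)
  | zero => rw [conv_zero_left, conv_zero_right]
  | add a b ha hb h1 h2 =>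
    rw [conv_add_left p.2, conv_add_right (gammaUnitSubgroup_le 𝒪 ha)
      (gammaUnitSubgroup_le 𝒪 hb), h1, h2]
  | neg a _ h => rw [conv_neg_left, conv_neg_right, h]

/-- If the diagonal subring is maximal commutative, then every nonzero two-sided ideal contains a
nonzero element of the diagonal subring. -/
theorem eq_zero_of_mem_ideal (hmax : IsMaximalCommutative (gammaUnit 𝒪))
    {I : AddSubgroup (Gamma 𝒪)} (hl : ∀ f ∈ I, ∀ g, g * f ∈ I) (hr : ∀ f ∈ I, ∀ g, f * g ∈ I)
    (hI : ∀ f ∈ I, f ∈ gammaUnit 𝒪 → f = 0) {f : Gamma 𝒪} (hf : f ∈ I) : f = 0 := by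
  have key : ∀ (n : ℕ) (l : List (Gamma 𝒪)), l.length = n → (∀ g ∈ l, IsBisectional g) →
      l.sum ∈ I → l.sum = 0 := by
    intro n
    induction n using Nat.strong_induction_on with
    | _ n ih =>
    intro l hn hlb hlI
    by_contra hne
    obtain ⟨γ, hγ⟩ : ∃ γ, l.sum.1 γ ≠ 0 := by
      by_contra! h
      exact hne (Subtype.ext (funext h))
    obtain ⟨g, hg, hgγ⟩ := exists_mul_apply_unit l.sum γ
    have hsum : ∀ (q : List (Gamma 𝒪)) (β : Arr X), (∀ k ∈ q, k.1 β = 0) → q.sum.1 β = 0 := by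
      intro q β hq
      induction q with
      | nil => rfl
      | cons k q ihq =>
        rw [List.sum_cons]
        refine (congrArg₂ (· + ·) (hq k List.mem_cons_self)
          (ihq fun k hk => hq k (List.mem_cons_of_mem _ hk))).trans (add_zero _)
    have hmap : l.sum * g = (l.map (· * g)).sum := by
      simpa using (List.sum_map_mul_right l id g).symm
    obtain ⟨k, hk, hky⟩ : ∃ k ∈ l.map (· * g), k.1 ⟨γ.right, γ.right, 𝟙 γ.right⟩ ≠ 0 := by
      by_contra! h
      exact hγ (hgγ.symm.trans (hmap ▸ hsum _ _ h))
    have hb : ∀ j ∈ l.map (· * g), IsBisectional j := by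
      intro j hj
      obtain ⟨i, hi, rfl⟩ := List.mem_map.mp hj
      exact (hlb i hi).mul hg
    -- Splitting off the summand `k` that is nonzero at $y=r(\gamma)$ leaves a strictly shorter
    -- list.
    obtain ⟨q, hq⟩ : ∃ q, (l.map (· * g)).Perm (k :: q) := by
      classical exact ⟨_, List.perm_cons_erase hk⟩
    have hqlen : q.length < n := by
      have := hq.length_eq
      rw [List.length_map, List.length_cons, hn] at this
      omega
    obtain ⟨e, he, heu, he1, hke⟩ := exists_mul_mem_unit (hb k hk) hky
    set p := l.sum * g * e with hp
    have hpI : p ∈ I := hr _ (hr _ hlI g) e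
    have hpsum : p = k * e + (q.map (· * e)).sum := by
      rw [hp, hmap, hq.sum_eq, List.sum_cons, add_mul]
      congr 1
      simpa using (List.sum_map_mul_right q id e).symm
    have hpmem : p ∈ gammaUnit 𝒪 := by
      refine hmax.mem_of_commute fun a ha => commute_of_commute_generators ?_ ha
      intro a W hWu hW haW
      have haA : a ∈ gammaUnit 𝒪 := AddSubgroup.subset_closure ⟨W, hWu, hW, haW⟩
      let D : Gamma 𝒪 →+ Gamma 𝒪 := AddMonoidHom.mulLeft a - AddMonoidHom.mulRight a
      have hD : a * p - p * a = ((q.map (· * e)).map D).sum := by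
        have h1 : D p = D (k * e) + D (q.map (· * e)).sum := by rw [hpsum, map_add]
        -- Both `a` and `k * e` are diagonal, so this term drops out and the number of summands
        -- falls.
        have h2 : D (k * e) = 0 := sub_eq_zero.mpr (hmax.1 a haA (k * e) hke)
        rw [h2, zero_add, map_list_sum] at h1
        exact h1
      have hzero : a * p - p * a = 0 := by
        rw [hD]
        refine ih q.length hqlen _ (by simp) (fun j hj => ?_) ?_
        · obtain ⟨i, hi, rfl⟩ := List.mem_map.mp hj
          obtain ⟨i', hi', rfl⟩ := List.mem_map.mp hi
          exact ((hb i' (hq.symm.subset (List.mem_cons_of_mem _ hi'))).mul he).commutator hWu hW haW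
        · rw [← hD]
          exact sub_mem (hl p hpI a) (hr p hpI a)
      exact sub_eq_zero.mp hzero
    -- This contradicts the choice of `g` and `e`, which gives $p$ the value $f(\gamma)\neq0$ at
    -- this unit, where $f$ is the sum of `l`.
    have hp0 : p.1 ⟨γ.right, γ.right, 𝟙 γ.right⟩ = 0 := by
      rw [hI p hpI hpmem]
      rfl
    exact hγ (hgγ.symm.trans ((mul_apply_unit heu he1).symm.trans hp0))
  obtain ⟨l, hlb, rfl⟩ := exists_list_isBisectional f
  exact key _ l rfl hlb hf

end Ideals

/-! ### Faithfulness and semiprimitivity -/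

section Main

variable {X : Type u} [Groupoid.{v} X] [TopologicalSpace X] [TopologicalSpace (Arr X)]
  [IsAmpleGroupoid X] {𝒪 : GSheafOfRings.{u, v, w} X}

/-- An element of the diagonal subring that annihilates an induced module vanishes at the
corresponding unit. -/
theorem apply_unit_eq_zero_of_annihilates (h𝒪 : 𝒪.IsSheafOfFields) {f : Gamma 𝒪}
    (hf : f.1 ∈ gammaUnitSubgroup 𝒪) (x : X) (M : Type t) [AddCommGroup M]
    [Module (IsotropyRing 𝒪 x) M] [Nontrivial M]
    (h : ∀ n, indModule 𝒪 x M f n = 0) : f.1 ⟨x, x, 𝟙 x⟩ = 0 := by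
  classical
  by_contra hne
  -- Applying $f$ to $b1_x\otimes m$ with $b=f(x)^{-1}$ gives $1_x\otimes m$, which `indEval` sends
  -- to $m\neq0$.
  obtain ⟨b, hb⟩ := (h𝒪 x).mul_inv_cancel hne
  obtain ⟨m, hm⟩ := exists_ne (0 : M)
  have h1 := congrArg (indEval 𝒪 x M)
    (h (indTmul (DirectSum.of (fun γ : Out x => 𝒪.stalk γ.1) ⟨x, 𝟙 x⟩ b) m))
  rw [indModule_indTmul, leftAct_of_unit hf, indEval_indTmul, isotropyPart_of, map_zero] at h1
  dsimp only at h1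
  rw [hb] at h1
  exact hm ((one_smul (IsotropyRing 𝒪 x) m).symm.trans h1)

theorem isFaithful_directSumModule_indModule (h𝒪 : 𝒪.IsSheafOfFields)
    (hmax : IsMaximalCommutative (gammaUnit 𝒪)) (M : X → Type t) [∀ x, AddCommGroup (M x)]
    [∀ x, Module (IsotropyRing 𝒪 x) (M x)] [∀ x, Nontrivial (M x)] :
    IsFaithful (directSumModule fun x => indModule 𝒪 x (M x)) := by
  classical
  set ρ := directSumModule fun x => indModule 𝒪 x (M x) with hρ
  let I : AddSubgroup (Gamma 𝒪) :=
    (ρ : Gamma 𝒪 →+ AddMonoid.End (⨁ x, Ind 𝒪 x (M x))).ker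
  have hI : ∀ f, f ∈ I ↔ ρ f = 0 := fun f => AddMonoidHom.mem_ker
  intro f hf
  refine eq_zero_of_mem_ideal hmax (I := I) ?_ ?_ ?_ ((hI f).mpr (AddMonoidHom.ext hf))
  · intro f hf g
    rw [hI] at hf ⊢
    rw [map_mul, hf, mul_zero]
  · intro f hf g
    rw [hI] at hf ⊢
    rw [map_mul, hf, zero_mul]
  · intro f hf hfu
    rw [hI] at hf
    have hz : ∀ x, f.1 ⟨x, x, 𝟙 x⟩ = 0 := fun x => by
      refine apply_unit_eq_zero_of_annihilates h𝒪 hfu x (M x) fun n => ?_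
      apply DirectSum.of_injective (β := fun x => Ind 𝒪 x (M x)) x
      refine (directSumModule_of (fun x => indModule 𝒪 x (M x)) f x n).symm.trans ?_
      rw [← hρ, hf, map_zero]
      rfl
    apply Subtype.ext
    funext γ
    by_cases hγ : γ ∈ unitArrows X
    · obtain ⟨x, rfl⟩ := hγ
      exact hz x
    · exact apply_eq_zero_of_mem_unit hfu hγ

variable (𝒪) in
-- A maximal left ideal of the nonzero unital ring $B_x$ gives a simple quotient, needed because
-- semiprimitivity supplies no modules $M_x$.
theorem exists_isSimpleModule_isotropyRing (x : X) [Nontrivial (𝒪.stalk x)] :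
    ∃ J : Ideal (IsotropyRing 𝒪 x), IsSimpleModule (IsotropyRing 𝒪 x) (IsotropyRing 𝒪 x ⧸ J) := by
  obtain ⟨J, hJ⟩ := Ideal.exists_maximal (IsotropyRing 𝒪 x)
  exact ⟨J, isSimpleModule_iff_isCoatom.mpr hJ.1⟩

end Main

end SheafAlgebra

theorem mainTheorem9 {X : Type u} [Groupoid.{v} X] [TopologicalSpace X]
    [TopologicalSpace (SheafAlgebra.Arr X)] [SheafAlgebra.IsAmpleGroupoid X]
    (𝒪 : SheafAlgebra.GSheafOfRings.{u, v, w} X) (h𝒪 : 𝒪.IsSheafOfFields)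
    (hmax : SheafAlgebra.IsMaximalCommutative (SheafAlgebra.gammaUnit 𝒪)) :
    SheafAlgebra.IsSemiprimitive (SheafAlgebra.Gamma 𝒪) ∧
      ∀ (M : X → Type t) [∀ x, AddCommGroup (M x)]
        [∀ x, Module (SheafAlgebra.IsotropyRing 𝒪 x) (M x)]
        [∀ x, IsSimpleModule (SheafAlgebra.IsotropyRing 𝒪 x) (M x)],
        SheafAlgebra.IsSemisimple
            (SheafAlgebra.directSumModule fun x => SheafAlgebra.indModule 𝒪 x (M x)) ∧
          SheafAlgebra.IsFaithful
            (SheafAlgebra.directSumModule fun x => SheafAlgebra.indModule 𝒪 x (M x)) := by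
  classical
  refine ⟨?_, fun M _ _ _ => ?_⟩
  · have hnt : ∀ x, Nontrivial (𝒪.stalk x) := fun x => ⟨(h𝒪 x).exists_pair_ne⟩
    -- For these quotients $\mathrm{Ind}_x$ lies in the universe of $\Gamma_c(\mathscr G,\mathcal
    -- O)$, over which `jacobsonRadical` quantifies.
    choose J hJ using fun x => SheafAlgebra.exists_isSimpleModule_isotropyRing 𝒪 x
    have hJn : ∀ x, Nontrivial (SheafAlgebra.IsotropyRing 𝒪 x ⧸ J x) := fun x =>
      IsSimpleModule.nontrivial (SheafAlgebra.IsotropyRing 𝒪 x) _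
    refine Set.Subset.antisymm (fun f hf => ?_) (fun f hf N _ ρ _ m => ?_)
    · refine SheafAlgebra.isFaithful_directSumModule_indModule h𝒪 hmax
        (fun x => SheafAlgebra.IsotropyRing 𝒪 x ⧸ J x) f fun m => ?_
      induction m using DirectSum.induction_on with
      | zero => exact map_zero _
      | of x n =>
        rw [SheafAlgebra.directSumModule_of,
          hf _ _ (SheafAlgebra.isSimple_indModule 𝒪 x _) n, map_zero]
      | add a b h1 h2 => rw [map_add, h1, h2, add_zero]
    · rw [Set.mem_singleton_iff.mp hf, map_zero]
      rfl
  · have hM : ∀ x, Nontrivial (M x) := fun x =>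
      IsSimpleModule.nontrivial (SheafAlgebra.IsotropyRing 𝒪 x) _
    exact ⟨SheafAlgebra.isSemisimple_directSumModule _ fun x =>
      SheafAlgebra.isSimple_indModule 𝒪 x (M x),
      SheafAlgebra.isFaithful_directSumModule_indModule h𝒪 hmax M⟩
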